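/- Theorem. Let $\mathbb{F}$ be $\mathbb{R}$ or $\mathbb{C}$ and let $A$ be an $n\times n$ matrix over $\mathbb{F}$. For $m\times n$ matrices $X,Y$ write $(X;Y)$ for the $m\times n\times 2$ tensor with slices $X$ and $Y$. Its rank $\mathrm{rank}_{\mathbb{F}}(X;Y)$ is the least $r$ such that it is a sum of $r$ tensors of the form $a\otimes b\otimes c$ with $a\in\mathbb{F}^m$, $b\in\mathbb{F}^n$, $c\in\mathbb{F}^2$. For $m=n$, the tensor $(X;Y)$ is called diagonalizable if there are nonsingular matrices $P,Q$ over $\mathbb{F}$ such that $PXQ$ and $PYQ$ are both diagonal. Let $E_k$ be the $k\times k$ identity matrix, $J_k$ the $k\times k$ matrix with ones directly above the diagonal and zeros elsewhere, and $C_k(c,s)=E_k\otimes\begin{pmatrix}c&-s\\ s&c\end{pmatrix}$. The matrix $A$ is similar over $\mathbb{F}$ to a block diagonal matrix (a Jordan form of $A$) each of whose blocks is either of the form $xE_k+J_k$ with $x\in\mathbb{F}$ and $k\ge1$ (a block of size $k$ for the eigenvalue $x$) or, only if $\mathbb{F}=\mathbb{R}$, of the form $C_k(c,s)+J_k\otimes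 E_2$ with $c,s\in\mathbb{R}$, $s\neq0$ and $k\ge1$ (a block of size $2k$ for each of the two eigenvalues $c\pm s\sqrt{-1}$). For any such Jordan form of $A$ and any $x\in\mathbb{C}$, let $\alpha_{\mathbb{F}}(A,x)$ be the number of its blocks of size at least $2$ for the eigenvalue $x$. Then $$\mathrm{rank}_{\mathbb{F}}(E_n;A)=n+\max_{x\in\mathbb{C}}\alpha_{\mathbb{F}}(A,x).$$ Furthermore, there are $\max_{x\in\mathbb{C}}\alpha_{\mathbb{F}}(A,x)$ tensors of rank $1$ over $\mathbb{F}$ such that $(E_n;A)$ plus their sum is diagonalizable. -/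

import Mathlib

open scoped Kronecker

/-- `m × n × 2` tensors over `F`, given by their two `m × n` slices: `(A; B)` is `![A, B]`. -/
abbrev TwoSliceTensor (F : Type*) (m n : ℕ) : Type _ :=
  Fin 2 → Matrix (Fin m) (Fin n) F

/-- `T` is a sum of `r` tensors of the form `a ⊗ b ⊗ c`. -/
def IsSumOfPureTensors {F : Type*} [Field F] {m n : ℕ} (T : TwoSliceTensor F m n) (r : ℕ) :
    Prop :=
  ∃ (a : Fin r → Fin m → F) (b : Fin r → Fin n → F) (c : Fin r → Fin 2 → F),
    T = fun k => ∑ j, c j k • Matrix.vecMulVec (a j) (b j)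

/-- Every tensor is a finite sum of pure tensors, so that the rank below is a minimum. -/
theorem exists_isSumOfPureTensors {F : Type*} [Field F] {m n : ℕ} (T : TwoSliceTensor F m n) :
    ∃ r, IsSumOfPureTensors T r := by
  let e := Fintype.equivFin (Fin m × Fin n × Fin 2)
  refine ⟨_, fun j => Pi.single (e.symm j).1 1, fun j => Pi.single (e.symm j).2.1 1,
    fun j => Pi.single (e.symm j).2.2 (T (e.symm j).2.2 (e.symm j).1 (e.symm j).2.1), ?_⟩
  funext k
  rw [e.symm.sum_comp (fun p : Fin m × Fin n × Fin 2 =>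
    (Pi.single p.2.2 (T p.2.2 p.1 p.2.1) : Fin 2 → F) k •
      Matrix.vecMulVec (Pi.single p.1 1) (Pi.single p.2.1 1))]
  ext i j
  rw [Matrix.sum_apply, Finset.sum_eq_single (i, j, k)]
  · simp [Matrix.vecMulVec_apply]
  · rintro ⟨i', j', k'⟩ - hne
    simp only [Matrix.smul_apply, Matrix.vecMulVec_apply, Pi.single_apply, smul_eq_mul]
    split_ifs <;> simp_all
  · simp

/-- The rank of a tensor: the least number of pure tensors that sum to it. -/
noncomputable def tensorRank {F : Type*} [Field F] {m n : ℕ} (T : TwoSliceTensor F m n) : ℕ :=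
  sInf {r | IsSumOfPureTensors T r}

/-- Simultaneous diagonalizability of the slices: `P T Q` has slices `(D, O)` (if `m ≤ n`) or
`(D, O)ᵀ` (if `m > n`) with `D` diagonal, for some nonsingular `P` and `Q`. -/
def IsDiagonalizableTensor {F : Type*} [Field F] {m n : ℕ} (T : TwoSliceTensor F m n) : Prop :=
  ∃ (P : GL (Fin m) F) (Q : GL (Fin n) F), ∀ (k : Fin 2) (i : Fin m) (j : Fin n),
    (i : ℕ) ≠ (j : ℕ) →
      ((P : Matrix (Fin m) (Fin m) F) * T k * (Q : Matrix (Fin n) (Fin n) F)) i j = 0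

/-- The `k × k` matrix `J_k` with ones directly above the diagonal and zeros elsewhere. -/
def nilpotentJordan (F : Type*) [Field F] (k : ℕ) : Matrix (Fin k) (Fin k) F :=
  Matrix.of fun i j => if (i : ℕ) + 1 = (j : ℕ) then 1 else 0

/-- `x E_k + J_k`. -/
def jordanMatrix {F : Type*} [Field F] (x : F) (k : ℕ) : Matrix (Fin k) (Fin k) F :=
  x • (1 : Matrix (Fin k) (Fin k) F) + nilpotentJordan F k

/-- `C_k(c, s) + J_k ⊗ E_2`, where `C_k(c, s) = E_k ⊗ (c, -s; s, c)`. -/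
noncomputable def rotationJordanMatrix (c s : ℝ) (k : ℕ) : Matrix (Fin (k * 2)) (Fin (k * 2)) ℝ :=
  Matrix.reindex finProdFinEquiv finProdFinEquiv
    ((1 : Matrix (Fin k) (Fin k) ℝ) ⊗ₖ !![c, -s; s, c] +
      nilpotentJordan ℝ k ⊗ₖ (1 : Matrix (Fin 2) (Fin 2) ℝ))

/-- `A` is similar to the block diagonal matrix with diagonal blocks `B 0, …, B (r - 1)`
(the bijection `e` numbers the rows, and simultaneously the columns, of that matrix). -/
def IsSimilarToBlocks {F : Type*} [Field F] {n r : ℕ} {d : Fin r → ℕ}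
    (B : ∀ i, Matrix (Fin (d i)) (Fin (d i)) F) (A : Matrix (Fin n) (Fin n) F) : Prop :=
  ∃ (e : (Σ i, Fin (d i)) ≃ Fin n) (P : GL (Fin n) F),
    A = (P : Matrix (Fin n) (Fin n) F) *
      Matrix.reindex e e (Matrix.blockDiagonal' B) *
      ((P⁻¹ : GL (Fin n) F) : Matrix (Fin n) (Fin n) F)

/-- A Jordan block over `ℂ`. -/
structure ComplexJordanBlock where
  eigenvalue : ℂ
  size : ℕ
  size_pos : 0 < size

namespace ComplexJordanBlock

/-- The matrix of a block. -/
noncomputable def matrix (b : ComplexJordanBlock) : Matrix (Fin b.size) (Fin b.size) ℂ :=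
  jordanMatrix b.eigenvalue b.size

/-- The block list `J` is a Jordan canonical form of the complex matrix `A`. -/
def IsJordanForm {n r : ℕ} (J : Fin r → ComplexJordanBlock) (A : Matrix (Fin n) (Fin n) ℂ) :
    Prop :=
  IsSimilarToBlocks (fun i => (J i).matrix) A

/-- The number of blocks of size at least `2` for the eigenvalue `x`. -/
noncomputable def alpha {r : ℕ} (J : Fin r → ComplexJordanBlock) (x : ℂ) : ℕ :=
  Nat.card {i : Fin r // (J i).eigenvalue = x ∧ 2 ≤ (J i).size}

end ComplexJordanBlock

/-- A real Jordan block: either `x E_k + J_k` with `x` real, or `C_k(c, s) + J_k ⊗ E_2` with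
`s ≠ 0`. -/
inductive RealJordanBlock where
  | real (x : ℝ) (k : ℕ) (hk : 0 < k)
  | nonreal (c s : ℝ) (hs : s ≠ 0) (k : ℕ) (hk : 0 < k)

namespace RealJordanBlock

/-- The size of a block; `C_k(c, s) + J_k ⊗ E_2` has size `2k`. -/
def size : RealJordanBlock → ℕ
  | real _ k _ => k
  | nonreal _ _ _ k _ => k * 2

/-- The matrix of a block. -/
noncomputable def matrix : (b : RealJordanBlock) → Matrix (Fin b.size) (Fin b.size) ℝ
  | real x k _ => jordanMatrix x k
  | nonreal c s _ k _ => rotationJordanMatrix c s k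

/-- `x : ℂ` is an eigenvalue of the block: `C_k(c, s) + J_k ⊗ E_2` has the two complex
eigenvalues `c ± s i`. -/
def IsFor : RealJordanBlock → ℂ → Prop
  | real y _ _, x => x = (y : ℂ)
  | nonreal c s _ _ _, x => x = ⟨c, s⟩ ∨ x = ⟨c, -s⟩

/-- The block list `J` is a real Jordan canonical form of the real matrix `A`. -/
def IsJordanForm {n r : ℕ} (J : Fin r → RealJordanBlock) (A : Matrix (Fin n) (Fin n) ℝ) :
    Prop :=
  IsSimilarToBlocks (fun i => (J i).matrix) A

/-- The number of blocks of size at least `2` for the (real or non-real) eigenvalue `x`. -/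
noncomputable def alpha {r : ℕ} (J : Fin r → RealJordanBlock) (x : ℂ) : ℕ :=
  Nat.card {i : Fin r // (J i).IsFor x ∧ 2 ≤ (J i).size}

end RealJordanBlock

/-- The values `alpha J x` are bounded, so that their supremum is a maximum. -/
theorem ComplexJordanBlock.alpha_bddAbove {r : ℕ} (J : Fin r → ComplexJordanBlock) :
    BddAbove (Set.range (ComplexJordanBlock.alpha J)) := by
  refine ⟨r, ?_⟩
  rintro _ ⟨x, rfl⟩
  simpa [ComplexJordanBlock.alpha] using Finite.card_subtype_le (α := Fin r)
    (fun i => (J i).eigenvalue = x ∧ 2 ≤ (J i).size)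

/-- The values `alpha J x` are bounded, so that their supremum is a maximum. -/
theorem RealJordanBlock.alpha_bddAbove {r : ℕ} (J : Fin r → RealJordanBlock) :
    BddAbove (Set.range (RealJordanBlock.alpha J)) := by
  refine ⟨r, ?_⟩
  rintro _ ⟨x, rfl⟩
  simpa [RealJordanBlock.alpha] using Finite.card_subtype_le (α := Fin r)
    (fun i => (J i).IsFor x ∧ 2 ≤ (J i).size)

/-!
A generating cyclic family for an endomorphism `M` (`IsCyclicFamily`) consists of vectors `e i` that
exhibit `V` as the direct sum of the `F[X]`-modules `F[X] ⧸ (q i)`, with `X` acting through `M`.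
Taylor coefficients show that each Jordan block has a cyclic vector whose annihilator is a power of
an irreducible polynomial (`jordanMatrix_exists_generator`,
`rotationJordanMatrix_exists_generator`). The structure theorem for modules over `F[X]` provides
cyclic families for all matrices, and two generating families with the same annihilators give
similar matrices; this yields the Jordan form (`exists_isSimilarToBlocks`).

Let `m` be the maximum of the numbers `α(x)`. For the upper bound, distribute the blocks of size at
least `2` to `m` classes such that no two blocks in a class share an eigenvalue. The annihilators in
a class are coprime, so the sum of the corresponding blocks is cyclic: a companion matrix. Changing
its last column, a perturbation of rank one, replaces its characteristic polynomial by
`X (X - 1) (X - 2) ⋯`, which has simple roots in `F`. Hence `m` terms of rank one make `(1; A)`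
diagonalizable (`IsCyclicFamily.exists_diagonalizable_add`), and a diagonalizable tensor has rank at
most `n`.

For the lower bound, a decomposition of `(1; A)` into `R` pure tensors factors the identity as
`U H` and `A - x` as `U G` through `F ^ R`, with `H` and `G` obtained from one matrix by scaling its
rows. The kernel of `U` has dimension `R - n`, and a dimension count shows that it is at least the
dimension of `ker (A - x) ⊓ range (A - x)`
(`finrank_add_finrank_le_of_factorization`). For `x ∈ F` the latter is `α(x)`. If `F = ℝ` and `x` is
not real, the same argument over `ℂ` applies to all of `ker (A - x)`, whose dimension is `α(x)`,
because no row of `G` vanishes unless the same row of `H` does.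
-/

open Polynomial

/-! ### Polynomials in an endomorphism -/

section CyclicFamily

variable {F : Type*} [Field F] {V W : Type*} [AddCommGroup V] [Module F V]
  [AddCommGroup W] [Module F W]

theorem aeval_apply_of_intertwines {S : Module.End F V} {T : Module.End F W} (φ : V →ₗ[F] W)
    (h : ∀ v, φ (S v) = T (φ v)) (f : F[X]) (v : V) : φ (aeval S f v) = aeval T f (φ v) := by
  induction f using Polynomial.induction_on' generalizing v with
  | add f g hf hg => simp [hf, hg]
  | monomial k a =>
    have hk : ∀ k : ℕ, ∀ v, φ ((S ^ k) v) = (T ^ k) (φ v) := by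
      intro k
      induction k with
      | zero => simp
      | succ k ih => intro v; simp [pow_succ, ih, h]
    simp [aeval_monomial, Module.algebraMap_end_apply, hk]

/-- A linear map out of `F[X]` that turns multiplication by `X` into `T` is evaluation at `T`
of the image of `1`. -/
theorem aeval_apply_one_of_intertwines {T : Module.End F W} (φ : F[X] →ₗ[F] W)
    (h : ∀ f, φ (X * f) = T (φ f)) (f : F[X]) : aeval T f (φ 1) = φ f := by
  rw [← aeval_apply_of_intertwines (S := LinearMap.mulLeft F (X : F[X])) φ h f 1]
  congr 1
  induction f using Polynomial.induction_on' with
  | add f g hf hg => simp [hf, hg]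
  | monomial k a =>
    simp [Module.algebraMap_end_apply, LinearMap.pow_mulLeft, ← C_mul_X_pow_eq_monomial,
      smul_eq_C_mul]

variable {ι : Type*} [Fintype ι]

/-- The vectors `e i` satisfy no relations over `F[X]`, acting on `V` through `M`, except those
forced by the annihilators `q i`: the `F[X]`-submodule that they generate is the direct sum of
cyclic modules `F[X] ⧸ (q i)`. -/
def IsCyclicFamily (M : Module.End F V) (e : ι → V) (q : ι → F[X]) : Prop :=
  ∀ f : ι → F[X], ∑ i, aeval M (f i) (e i) = 0 ↔ ∀ i, q i ∣ f i

/-- The `F`-linear map `F[X]^ι → V` that evaluates polynomials at `M` and applies them to `e`. -/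
noncomputable def evalFamily (M : Module.End F V) (e : ι → V) : (ι → F[X]) →ₗ[F] V where
  toFun f := ∑ i, aeval M (f i) (e i)
  map_add' f g := by simp [Finset.sum_add_distrib]
  map_smul' a f := by simp [Finset.smul_sum]

theorem evalFamily_apply (M : Module.End F V) (e : ι → V) (f : ι → F[X]) :
    evalFamily M e f = ∑ i, aeval M (f i) (e i) := rfl

theorem evalFamily_X_mul (M : Module.End F V) (e : ι → V) (f : ι → F[X]) :
    evalFamily M e (fun i => X * f i) = M (evalFamily M e f) := by
  simp [evalFamily_apply]

theorem evalFamily_single [DecidableEq ι] (M : Module.End F V) (e : ι → V) (i : ι) (f : F[X]) :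
    evalFamily M e (Pi.single i f) = aeval M f (e i) := by
  rw [evalFamily_apply, Finset.sum_eq_single i]
  · simp
  · intro j _ hj; simp [Pi.single_eq_of_ne hj]
  · simp

theorem IsCyclicFamily.aeval_self {M : Module.End F V} {e : ι → V} {q : ι → F[X]}
    (h : IsCyclicFamily M e q) (i : ι) : aeval M (q i) (e i) = 0 := by
  classical
  rw [← evalFamily_single, evalFamily_apply, h]
  intro j
  by_cases hj : j = i
  · subst hj; simp
  · simp [hj]

/-- An endomorphism is determined up to conjugation by the annihilators of a generating cyclic
family. -/
theorem IsCyclicFamily.exists_linearEquiv {M : Module.End F V} {T : Module.End F W}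
    {e : ι → V} {e' : ι → W} {q q' : ι → F[X]} (hq : ∀ i, Associated (q i) (q' i))
    (h : IsCyclicFamily M e q) (h' : IsCyclicFamily T e' q')
    (hs : Function.Surjective (evalFamily M e)) (hs' : Function.Surjective (evalFamily T e')) :
    ∃ φ : V ≃ₗ[F] W, ∀ v, φ (M v) = T (φ v) := by
  have hker : LinearMap.ker (evalFamily M e) = LinearMap.ker (evalFamily T e') := by
    ext f
    rw [LinearMap.mem_ker, LinearMap.mem_ker, evalFamily_apply, evalFamily_apply, h f, h' f]
    exact forall_congr' fun i => (hq i).dvd_iff_dvd_left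
  let φ := ((evalFamily M e).quotKerEquivOfSurjective hs).symm ≪≫ₗ
    Submodule.quotEquivOfEq _ _ hker ≪≫ₗ (evalFamily T e').quotKerEquivOfSurjective hs'
  have hφ : ∀ f, φ (evalFamily M e f) = evalFamily T e' f := by
    intro f
    have : ((evalFamily M e).quotKerEquivOfSurjective hs).symm (evalFamily M e f) =
        Submodule.Quotient.mk f := by
      rw [LinearEquiv.symm_apply_eq]; rfl
    simp only [φ, LinearEquiv.trans_apply, this, Submodule.quotEquivOfEq_mk]
    rfl
  refine ⟨φ, fun v => ?_⟩
  obtain ⟨f, rfl⟩ := hs v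
  rw [← evalFamily_X_mul, hφ, hφ, evalFamily_X_mul]

/-- Annihilators that are pairwise coprime combine: if the `q i` are pairwise coprime within each
colour class, then the sum `E j` of the generators of colour `j` is again cyclic, and the powers
`M ^ a (E j)` form a basis of `V`. -/
theorem IsCyclicFamily.exists_basis [FiniteDimensional F V] {M : Module.End F V} {e : ι → V}
    {q : ι → F[X]} (h : IsCyclicFamily M e q) (hq : ∀ i, q i ≠ 0)
    (hdim : ∑ i, (q i).natDegree = Module.finrank F V)
    {J : Type*} [Fintype J] [DecidableEq J] (c : ι → J)
    (hc : ∀ i i', i ≠ i' → c i = c i' → IsCoprime (q i) (q i')) :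
    ∃ b : Module.Basis (Σ j : J, Fin (∑ i with c i = j, (q i).natDegree)) F V,
      ∀ j a, b ⟨j, a⟩ = (M ^ (a : ℕ)) (∑ i with c i = j, e i) := by
  classical
  let d : J → ℕ := fun j => ∑ i with c i = j, (q i).natDegree
  let w : (Σ j : J, Fin (d j)) → V := fun x => (M ^ (x.2 : ℕ)) (∑ i with c i = x.1, e i)
  have hli : LinearIndependent F w := by
    rw [Fintype.linearIndependent_iff]
    intro g hg
    let f : J → F[X] := fun j => ∑ a : Fin (d j), C (g ⟨j, a⟩) * X ^ (a : ℕ)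
    have hfc : ∀ j (a : Fin (d j)), (f j).coeff a = g ⟨j, a⟩ := by
      intro j a
      simp only [f, finsetSum_coeff, coeff_C_mul_X_pow, Fin.val_inj]
      simp
    have hfd : ∀ j, (f j).degree < d j := by
      intro j
      refine (degree_sum_le _ _).trans_lt ?_
      rw [Finset.sup_lt_iff (WithBot.bot_lt_coe _)]
      intro a _
      exact (degree_C_mul_X_pow_le _ _).trans_lt (by exact_mod_cast a.2)
    have hsum : ∑ i, aeval M (f (c i)) (e i) = 0 := by
      rw [← hg, Fintype.sum_sigma, ← Finset.sum_fiberwise (s := Finset.univ) (g := c)]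
      refine Finset.sum_congr rfl fun j _ => ?_
      calc ∑ i with c i = j, aeval M (f (c i)) (e i)
          = ∑ i with c i = j, aeval M (f j) (e i) :=
            Finset.sum_congr rfl fun i hi => by rw [(Finset.mem_filter.1 hi).2]
        _ = aeval M (f j) (∑ i with c i = j, e i) := (map_sum _ _ _).symm
        _ = _ := by
          simp only [w]
          generalize ∑ i with c i = j, e i = u
          simp [f, Module.algebraMap_end_apply, LinearMap.sum_apply]
    have hdvd := (h fun i => f (c i)).1 hsum
    have hf0 : ∀ j, f j = 0 := by
      intro j
      have hprod : (∏ i with c i = j, q i) ∣ f j := by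
        refine Finset.prod_dvd_of_coprime (fun i hi i' hi' hne => ?_) fun i hi => ?_
        · simp only [Finset.coe_filter, Finset.mem_univ, true_and, Set.mem_ofPred_eq] at hi hi'
          exact hc i i' hne (hi.trans hi'.symm)
        · simpa [(Finset.mem_filter.1 hi).2] using hdvd i
      refine eq_zero_of_dvd_of_degree_lt hprod ?_
      rw [degree_prod, Finset.sum_congr rfl fun i _ => degree_eq_natDegree (hq i)]
      simpa [d] using hfd j
    rintro ⟨j, a⟩
    rw [← hfc, hf0, coeff_zero]
  have hcard : Fintype.card (Σ j : J, Fin (d j)) = Module.finrank F V := by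
    rw [← hdim, ← Finset.sum_fiberwise (s := Finset.univ) (g := c)]
    simp [d]
  by_cases hne : Nonempty (Σ j : J, Fin (d j))
  · exact ⟨basisOfLinearIndependentOfCardEqFinrank hli hcard, fun j a => by
      simp [w]⟩
  · rw [not_nonempty_iff] at hne
    have : Module.finrank F V = 0 := by rw [← hcard]; simp
    have := Module.finrank_zero_iff.1 this
    exact ⟨Module.Basis.empty V, fun j a => (hne.false ⟨j, a⟩).elim⟩

/-- A cyclic family generates `V` as soon as the degrees of the annihilators add up to `dim V`. -/
theorem IsCyclicFamily.surjective [FiniteDimensional F V] {M : Module.End F V} {e : ι → V}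
    {q : ι → F[X]} (h : IsCyclicFamily M e q) (hq : ∀ i, q i ≠ 0)
    (hdim : ∑ i, (q i).natDegree = Module.finrank F V) :
    Function.Surjective (evalFamily M e) := by
  classical
  obtain ⟨b, hb⟩ := h.exists_basis hq hdim id fun i i' hne he => absurd he hne
  rw [← LinearMap.range_eq_top, eq_top_iff, ← b.span_eq, Submodule.span_le]
  rintro _ ⟨⟨j, a⟩, rfl⟩
  refine ⟨Pi.single j (X ^ (a : ℕ)), ?_⟩
  have hj : ∑ i with id i = j, e i = e j := by simp [Finset.sum_filter]
  rw [evalFamily_single, hb, hj]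
  simp

/-- The structure theorem for finitely generated torsion modules over `F[X]`, in terms of cyclic
families. -/
theorem exists_isCyclicFamily [FiniteDimensional F V] (M : Module.End F V) :
    ∃ (r : ℕ) (p : Fin r → F[X]) (k : Fin r → ℕ) (e : Fin r → V),
      (∀ i, Irreducible (p i)) ∧ (∀ i, 0 < k i) ∧
      IsCyclicFamily M e (fun i => p i ^ k i) ∧ Function.Surjective (evalFamily M e) := by
  classical
  obtain ⟨ι, _, p, hp, k, ⟨φ⟩⟩ := Module.equiv_directSum_of_isTorsion
    (R := F[X]) (M := Module.AEval' M) (Module.AEval.isTorsion_of_finiteDimensional F V M)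
  let of := Module.AEval'.of M
  -- the generator of the `i`-th summand
  let e : ι → V := fun i => of.symm (φ.symm (DirectSum.lof F[X] ι (fun i => F[X] ⧸ F[X] ∙ p i ^ k i)
    i (Submodule.Quotient.mk 1)))
  have hev : ∀ i (f : F[X]), aeval M f (e i) = of.symm (φ.symm
      (DirectSum.lof F[X] ι (fun i => F[X] ⧸ F[X] ∙ p i ^ k i) i (Submodule.Quotient.mk f))) := by
    intro i f
    have h1 : (Submodule.Quotient.mk f : F[X] ⧸ F[X] ∙ p i ^ k i) =
        f • Submodule.Quotient.mk 1 := by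
      rw [← Submodule.Quotient.mk_smul, smul_eq_mul, mul_one]
    rw [h1, map_smul, map_smul]
    exact (Module.AEval.of_symm_smul M f _).symm
  have hsum : ∀ f : ι → F[X], ∑ i, aeval M (f i) (e i) = of.symm (φ.symm
      (∑ i, DirectSum.lof F[X] ι (fun i => F[X] ⧸ F[X] ∙ p i ^ k i) i
        (Submodule.Quotient.mk (f i)))) := by
    intro f
    rw [map_sum, map_sum]
    exact Finset.sum_congr rfl fun i _ => hev i (f i)
  have hcoord : ∀ (f : ι → F[X]) i, (∑ i, DirectSum.lof F[X] ι
      (fun i => F[X] ⧸ F[X] ∙ p i ^ k i) i (Submodule.Quotient.mk (f i))) i =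
      Submodule.Quotient.mk (f i) := by
    intro f i
    rw [DirectSum.sum_apply, Finset.sum_eq_single i]
    · exact DirectSum.lof_apply _ _ _
    · intro j _ hj
      exact DirectSum.of_eq_of_ne _ _ _ hj.symm
    · simp
  have hcyc : IsCyclicFamily M e (fun i => p i ^ k i) := by
    intro f
    rw [hsum, LinearEquiv.map_eq_zero_iff, LinearEquiv.map_eq_zero_iff, DirectSum.ext_iff]
    refine forall_congr' fun i => ?_
    rw [hcoord, DirectSum.zero_apply, Submodule.Quotient.mk_eq_zero, Submodule.mem_span_singleton]
    exact ⟨fun ⟨a, ha⟩ => ⟨a, by rw [← ha, smul_eq_mul, mul_comm]⟩,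
      fun ⟨a, ha⟩ => ⟨a, by rw [ha, smul_eq_mul, mul_comm]⟩⟩
  have hsurj : Function.Surjective (evalFamily M e) := by
    intro v
    choose f hf using fun i => Submodule.Quotient.mk_surjective (F[X] ∙ p i ^ k i) (φ (of v) i)
    refine ⟨f, ?_⟩
    rw [evalFamily_apply, hsum, LinearEquiv.symm_apply_eq, LinearEquiv.symm_apply_eq,
      DirectSum.ext_iff]
    intro i
    rw [hcoord, hf]
  -- summands with exponent `0` vanish and are left out
  let s := {i : ι // 0 < k i}
  have he0 : ∀ i, ¬ 0 < k i → e i = 0 := by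
    intro i hi
    have := (hcyc (Pi.single i 1)).2 fun j => by
      by_cases hj : j = i
      · subst hj; simp [Nat.eq_zero_of_not_pos hi]
      · simp [hj]
    rw [← evalFamily_apply, evalFamily_single] at this
    simpa using this
  have hsub : ∀ f : ι → F[X], ∑ i, aeval M (f i) (e i) = ∑ i : s, aeval M (f i) (e i) := by
    intro f
    rw [← Fintype.sum_subtype_add_sum_subtype (fun i => 0 < k i), add_eq_left]
    exact Finset.sum_eq_zero fun i _ => by rw [he0 i i.2, map_zero]
  let E := (Fintype.equivFin s).symm
  refine ⟨Fintype.card s, fun i => p (E i), fun i => k (E i), fun i => e (E i),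
    fun i => hp _, fun i => (E i).2, fun f => ?_, fun v => ?_⟩
  · let g : ι → F[X] := fun i => if hi : 0 < k i then f (E.symm ⟨i, hi⟩) else 0
    have hg : ∀ i, g (E i) = f i := fun i => by simp [g, (E i).2]
    have h1 := hcyc g
    rw [hsub, ← E.sum_comp] at h1
    simp only [hg] at h1
    rw [h1]
    refine ⟨fun h i => by simpa [hg] using h (E i), fun h i => ?_⟩
    by_cases hi : 0 < k i
    · simpa [g, hi] using h (E.symm ⟨i, hi⟩)
    · simp [g, hi]
  · obtain ⟨f, rfl⟩ := hsurj v
    exact ⟨fun i => f (E i), by rw [evalFamily_apply, evalFamily_apply, hsub, ← E.sum_comp]⟩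

end CyclicFamily

/-! ### Generators of the Jordan blocks -/

section Blocks

/-- On the reversed Taylor coefficients at `x`, multiplication by `X` acts as `x • 1 + J`. -/
theorem coeff_taylor_X_mul {F : Type*} [Field F] (x : F) (f : F[X]) {k i : ℕ} (hi : i < k) :
    (taylor x (X * f)).coeff (k - 1 - i) = x * (taylor x f).coeff (k - 1 - i) +
      if i + 1 < k then (taylor x f).coeff (k - 1 - (i + 1)) else 0 := by
  rw [taylor_mul, taylor_X, add_mul, coeff_add, coeff_C_mul, add_comm]
  congr 1
  split_ifs with h
  · obtain ⟨m, hm⟩ : ∃ m, k - 1 - i = m + 1 := ⟨k - 1 - i - 1, by omega⟩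
    rw [hm, coeff_X_mul, show k - 1 - (i + 1) = m by omega]
  · rw [show k - 1 - i = 0 by omega, coeff_X_mul_zero]

theorem X_sub_C_pow_dvd_iff_coeff_taylor {F : Type*} [Field F] (x : F) (f : F[X]) (k : ℕ) :
    (X - C x) ^ k ∣ f ↔ ∀ i : Fin k, (taylor x f).coeff (k - 1 - i) = 0 := by
  have h1 : (X - C x) ^ k ∣ f ↔ X ^ k ∣ taylor x f := by
    have h2 : taylorEquiv x (X - C x) = X := by
      change taylor x (X - C x) = X
      rw [map_sub, taylor_X, taylor_C, add_sub_cancel_right]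
    rw [← map_dvd_iff (taylorEquiv x), map_pow, h2]
    rfl
  rw [h1, X_pow_dvd_iff]
  refine ⟨fun h i => h _ (by omega), fun h d hd => ?_⟩
  have := h ⟨k - 1 - d, by omega⟩
  rwa [show k - 1 - (k - 1 - d) = d by omega] at this

theorem nilpotentJordan_mulVec {F : Type*} [Field F] {k : ℕ} (G : ℕ → F) (i : Fin k) :
    (nilpotentJordan F k).mulVec (fun j => G j) i = if (i : ℕ) + 1 < k then G (i + 1) else 0 := by
  simp only [Matrix.mulVec, dotProduct, nilpotentJordan, Matrix.of_apply, ite_mul, one_mul,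
    zero_mul]
  split_ifs with h
  · rw [Finset.sum_eq_single ⟨i + 1, h⟩]
    · simp
    · intro j _ hj
      rw [if_neg]
      intro h'
      exact hj (Fin.ext h'.symm)
    · simp
  · refine Finset.sum_eq_zero fun j _ => if_neg ?_
    omega

/-- A Jordan block has a cyclic vector: reversed Taylor coefficients at `x` identify
`F[X] ⧸ ((X - x) ^ k)` with `F ^ k`, and multiplication by `X` with the block. -/
theorem jordanMatrix_exists_generator {F : Type*} [Field F] (x : F) (k : ℕ) :
    ∃ g : Fin k → F, ∀ f : F[X],
      aeval (Matrix.toLin' (jordanMatrix x k)) f g = 0 ↔ (X - C x) ^ k ∣ f := by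
  let Ψ : F[X] →ₗ[F] (Fin k → F) :=
    LinearMap.pi fun i => (lcoeff F (k - 1 - i)).comp (taylor x)
  refine ⟨Ψ 1, fun f => ?_⟩
  rw [aeval_apply_one_of_intertwines Ψ, X_sub_C_pow_dvd_iff_coeff_taylor]
  · exact funext_iff
  · intro f
    ext i
    have h := nilpotentJordan_mulVec (fun j => (taylor x f).coeff (k - 1 - j)) i
    change (taylor x (X * f)).coeff (k - 1 - i) =
      (jordanMatrix x k).mulVec (fun j : Fin k => (taylor x f).coeff (k - 1 - j)) i
    rw [jordanMatrix, Matrix.add_mulVec, Pi.add_apply, h, coeff_taylor_X_mul x f i.2,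
      Matrix.smul_mulVec, Matrix.one_mulVec]
    rfl

/-- The real polynomial with the roots `c ± s i`. -/
noncomputable def conjPairPoly (c s : ℝ) : ℝ[X] := (X - C c) ^ 2 + C (s ^ 2)

theorem conjPairPoly_eq (c s : ℝ) :
    conjPairPoly c s = X ^ 2 - C (2 * c) * X + C (c ^ 2 + s ^ 2) := by
  simp only [conjPairPoly, C_add, C_mul, C_pow, map_ofNat]; ring

theorem conjPairPoly_monic (c s : ℝ) : (conjPairPoly c s).Monic := by
  rw [conjPairPoly_eq]; monicity!

theorem conjPairPoly_natDegree (c s : ℝ) : (conjPairPoly c s).natDegree = 2 := by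
  rw [conjPairPoly_eq]; compute_degree!

theorem conjPairPoly_map (c s : ℝ) : (conjPairPoly c s).map (algebraMap ℝ ℂ) =
    (X - C ⟨c, s⟩) * (X - C ⟨c, -s⟩) := by
  have h1 : (⟨c, s⟩ : ℂ) = c + s * Complex.I := Complex.mk_eq_add_mul_I c s
  have h2 : (⟨c, -s⟩ : ℂ) = c - s * Complex.I := by
    rw [Complex.mk_eq_add_mul_I]; push_cast; ring
  have h3 : (C Complex.I : ℂ[X]) ^ 2 = -1 := by rw [← C_pow, Complex.I_sq]; simp
  rw [h1, h2]
  simp only [conjPairPoly, Polynomial.map_add, Polynomial.map_pow, Polynomial.map_sub, map_X,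
    map_C, Complex.coe_algebraMap, C_add, C_sub, C_mul, C_pow]
  linear_combination (C (s : ℂ)) ^ 2 * h3

theorem aeval_conjPairPoly (c s : ℝ) (z : ℂ) :
    aeval z (conjPairPoly c s) = 0 ↔ z = ⟨c, s⟩ ∨ z = ⟨c, -s⟩ := by
  rw [← eval_map_algebraMap, conjPairPoly_map]
  simp [sub_eq_zero]

theorem conjPairPoly_irreducible {c s : ℝ} (hs : s ≠ 0) : Irreducible (conjPairPoly c s) := by
  rw [(conjPairPoly_monic c s).irreducible_iff_roots_eq_zero_of_degree_le_three
    (by rw [conjPairPoly_natDegree]) (by rw [conjPairPoly_natDegree]; norm_num)]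
  refine Multiset.eq_zero_of_forall_notMem fun a ha => ?_
  have h := (mem_roots'.1 ha).2
  simp only [conjPairPoly, IsRoot.def, eval_add, eval_pow, eval_sub, eval_X, eval_C] at h
  have := sq_nonneg (a - c)
  have := sq_pos_of_ne_zero hs
  linarith

/-- A power of the quadratic divides a real polynomial as soon as the same power of one of its
complex linear factors does. -/
theorem conjPairPoly_pow_dvd_iff {c s : ℝ} (hs : s ≠ 0) (k : ℕ) (f : ℝ[X]) :
    conjPairPoly c s ^ k ∣ f ↔ (X - C (⟨c, s⟩ : ℂ)) ^ k ∣ f.map (algebraMap ℝ ℂ) := by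
  rw [← map_dvd_map' (algebraMap ℝ ℂ), Polynomial.map_pow, conjPairPoly_map, mul_pow]
  refine ⟨fun h => (dvd_mul_right _ _).trans h, fun h => ?_⟩
  refine IsCoprime.mul_dvd (IsCoprime.pow (isCoprime_X_sub_C_of_isUnit_sub ?_)) h ?_
  · rw [isUnit_iff_ne_zero, sub_ne_zero, Ne, Complex.mk.injEq]
    intro h
    exact hs (by linarith [h.2])
  · -- complex conjugation of the coefficients fixes `f` and exchanges the linear factors
    obtain ⟨g, hg⟩ := h
    refine ⟨g.map (starRingEnd ℂ), ?_⟩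
    have := congrArg (Polynomial.map (starRingEnd ℂ)) hg
    rw [Polynomial.map_map, Polynomial.map_mul, Polynomial.map_pow, Polynomial.map_sub, map_X,
      map_C] at this
    have h1 : (starRingEnd ℂ).comp (algebraMap ℝ ℂ) = algebraMap ℝ ℂ := by
      ext; simp
    rw [h1] at this
    exact this

/-- A real Jordan block for a pair of nonreal eigenvalues has a cyclic vector: real and imaginary
parts of the reversed Taylor coefficients at `c + s i` identify `ℝ[X] ⧸ (((X - c)² + s²) ^ k)` with
`ℝ ^ (2 k)`, and multiplication by `X` with the block. -/
theorem rotationJordanMatrix_exists_generator {c s : ℝ} (hs : s ≠ 0) (k : ℕ) :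
    ∃ g : Fin (k * 2) → ℝ, ∀ f : ℝ[X],
      aeval (Matrix.toLin' (rotationJordanMatrix c s k)) f g = 0 ↔ conjPairPoly c s ^ k ∣ f := by
  let z : ℂ := ⟨c, s⟩
  let G : ℝ[X] → ℕ → ℂ := fun f i => (taylor z (f.map (algebraMap ℝ ℂ))).coeff (k - 1 - i)
  let u : ℂ → Fin 2 → ℝ := fun w => ![w.re, w.im]
  have hu_add : ∀ w w', u (w + w') = u w + u w' := fun w w' => by simp [u]
  have hu_smul : ∀ (a : ℝ) w, u (a • w) = a • u w := fun a w => by simp [u]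
  have hG_add : ∀ f g i, G (f + g) i = G f i + G g i := fun f g i => by simp [G]
  have hG_smul : ∀ (a : ℝ) f i, G (a • f) i = a • G f i := fun a f i => by
    simp [G, Polynomial.map_smul]
  let Ψ : ℝ[X] →ₗ[ℝ] (Fin (k * 2) → ℝ) :=
    { toFun f j := u (G f (finProdFinEquiv.symm j).1) (finProdFinEquiv.symm j).2
      map_add' f g := by
        funext j
        rw [hG_add, hu_add]
        rfl
      map_smul' a f := by
        funext j
        rw [hG_smul, hu_smul]
        rfl }
  have hΨ : ∀ f i a, Ψ f (finProdFinEquiv (i, a)) = u (G f i) a := by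
    intro f i a
    change u (G f (finProdFinEquiv.symm _).1) (finProdFinEquiv.symm _).2 = _
    rw [Equiv.symm_apply_apply]
  refine ⟨Ψ 1, fun f => ?_⟩
  rw [aeval_apply_one_of_intertwines Ψ, conjPairPoly_pow_dvd_iff hs,
    X_sub_C_pow_dvd_iff_coeff_taylor]
  · rw [funext_iff, ← finProdFinEquiv.forall_congr_right, Prod.forall]
    simp [hΨ, Fin.forall_fin_two, u, G, z, Complex.ext_iff]
  · intro f
    ext j
    obtain ⟨⟨i, a⟩, rfl⟩ := finProdFinEquiv.surjective j
    have hG : G (X * f) i = z * G f i + if (i : ℕ) + 1 < k then G f (i + 1) else 0 := by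
      have := coeff_taylor_X_mul z (f.map (algebraMap ℝ ℂ)) i.2
      simpa [G] using this
    have hvec : (Ψ f) ∘ finProdFinEquiv = fun p : Fin k × Fin 2 => u (G f p.1) p.2 := by
      ext p; exact hΨ f p.1 p.2
    have hN : ∀ b, ∑ x : Fin k, nilpotentJordan ℝ k i x * u (G f x) b =
        if (i : ℕ) + 1 < k then u (G f (i + 1)) b else 0 := fun b =>
      nilpotentJordan_mulVec (fun x => u (G f x) b) i
    rw [hΨ, hG, rotationJordanMatrix, Matrix.toLin'_apply, Matrix.reindex_apply,
      Matrix.submatrix_mulVec_equiv]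
    simp only [Equiv.symm_symm, Function.comp_apply, Equiv.symm_apply_apply, hvec]
    rw [Matrix.add_mulVec, Pi.add_apply]
    simp only [Matrix.mulVec, dotProduct, Matrix.kroneckerMap_apply, Fintype.sum_prod_type,
      Matrix.one_apply, Fin.sum_univ_two]
    fin_cases a
    · have h0 : ∑ x : Fin k, nilpotentJordan ℝ k i x * (G f x).re =
          if (i : ℕ) + 1 < k then (G f (i + 1)).re else 0 := hN 0
      simp [u, z, Finset.sum_add_distrib, h0]
      split_ifs <;> simp [sub_eq_add_neg]
    · have h0 : ∑ x : Fin k, nilpotentJordan ℝ k i x * (G f x).im =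
          if (i : ℕ) + 1 < k then (G f (i + 1)).im else 0 := hN 1
      simp [u, z, Finset.sum_add_distrib]
      rw [h0]
      split_ifs <;> simp <;> ring

end Blocks

/-! ### Similarity to block diagonal matrices and the Jordan form -/

section Similarity

variable {F : Type*} [Field F] {n r : ℕ} {d : Fin r → ℕ}

theorem blockDiagonal'_mulVec_apply (B : ∀ i, Matrix (Fin (d i)) (Fin (d i)) F)
    (v : (Σ i, Fin (d i)) → F) (i : Fin r) (a : Fin (d i)) :
    (Matrix.blockDiagonal' B).mulVec v ⟨i, a⟩ = (B i).mulVec (fun b => v ⟨i, b⟩) a := by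
  simp only [Matrix.mulVec, dotProduct, Fintype.sum_sigma]
  rw [Finset.sum_eq_single i]
  · simp
  · intro j _ hj
    exact Finset.sum_eq_zero fun b _ => by
      rw [Matrix.blockDiagonal'_apply_ne _ _ _ hj.symm, zero_mul]
  · simp

/-- Similarity in terms of linear maps; the numbering of the rows is immaterial. -/
theorem isSimilarToBlocks_iff (B : ∀ i, Matrix (Fin (d i)) (Fin (d i)) F)
    (A : Matrix (Fin n) (Fin n) F) :
    IsSimilarToBlocks B A ↔ ∃ φ : ((Σ i, Fin (d i)) → F) ≃ₗ[F] (Fin n → F),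
      ∀ v, φ (Matrix.toLin' (Matrix.blockDiagonal' B) v) = Matrix.toLin' A (φ v) := by
  constructor
  · rintro ⟨e, P, rfl⟩
    refine ⟨LinearEquiv.funCongrLeft F F e.symm ≪≫ₗ
      Matrix.toLin'OfInv (M := (P⁻¹ : GL (Fin n) F).1) (M' := P.1) (by simp) (by simp), fun v => ?_⟩
    have h : ∀ v, (LinearEquiv.funCongrLeft F F e.symm ≪≫ₗ
        Matrix.toLin'OfInv (M := (P⁻¹ : GL (Fin n) F).1) (M' := P.1) (by simp) (by simp)) v =
        P.1.mulVec (v ∘ e.symm) := fun v => rfl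
    rw [h, h, Matrix.toLin'_apply, Matrix.toLin'_apply, Matrix.mulVec_mulVec, Matrix.mul_assoc,
      ← Units.val_mul, inv_mul_cancel, Units.val_one, Matrix.mul_one, ← Matrix.mulVec_mulVec,
      Matrix.reindex_apply, Matrix.submatrix_mulVec_equiv, Equiv.symm_symm, Function.comp_assoc,
      Equiv.symm_comp_self, Function.comp_id]
  · rintro ⟨φ, hφ⟩
    have hcard : Fintype.card (Σ i, Fin (d i)) = Fintype.card (Fin n) := by
      simpa using φ.finrank_eq
    let e := Fintype.equivOfCardEq hcard
    let ψ := LinearEquiv.funCongrLeft F F e ≪≫ₗ φ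
    let P : GL (Fin n) F := ⟨LinearMap.toMatrix' ψ.toLinearMap,
      LinearMap.toMatrix' ψ.symm.toLinearMap,
      by rw [← LinearMap.toMatrix'_comp]; simp, by rw [← LinearMap.toMatrix'_comp]; simp⟩
    refine ⟨e, P, ?_⟩
    refine (Units.eq_mul_inv_iff_mul_eq P).2 (Matrix.toLin'.injective (LinearMap.ext fun v => ?_))
    have hP : ∀ v, Matrix.toLin' P.1 v = φ (v ∘ e) := fun v => by
      change Matrix.toLin' (LinearMap.toMatrix' ψ.toLinearMap) v = _
      rw [Matrix.toLin'_toMatrix']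
      rfl
    rw [Matrix.toLin'_mul, Matrix.toLin'_mul, LinearMap.comp_apply, LinearMap.comp_apply, hP, hP,
      ← hφ, Matrix.toLin'_apply, Matrix.toLin'_apply, Matrix.reindex_apply,
      Matrix.submatrix_mulVec_equiv, Equiv.symm_symm, Function.comp_assoc, Equiv.symm_comp_self,
      Function.comp_id]

end Similarity

section CyclicBlocks

variable {F : Type*} [Field F] {n r : ℕ} {d : Fin r → ℕ}
  {B : ∀ i, Matrix (Fin (d i)) (Fin (d i)) F} {A : Matrix (Fin n) (Fin n) F}

theorem IsSimilarToBlocks.sum_size (h : IsSimilarToBlocks B A) : ∑ i, d i = n := by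
  obtain ⟨e, -⟩ := h
  simpa using Fintype.card_congr e

/-- Cyclic vectors `g i` of the blocks `B i`, extended by zero, form a cyclic family. -/
theorem isCyclicFamily_blockDiagonal' {g : ∀ i, Fin (d i) → F} {q : Fin r → F[X]}
    (hg : ∀ i f, aeval (Matrix.toLin' (B i)) f (g i) = 0 ↔ q i ∣ f) :
    IsCyclicFamily (Matrix.toLin' (Matrix.blockDiagonal' B))
      (fun i (x : Σ i, Fin (d i)) => (Pi.single i (g i) : ∀ j, Fin (d j) → F) x.1 x.2) q := by
  intro f
  let π : ∀ j, ((Σ i, Fin (d i)) → F) →ₗ[F] (Fin (d j) → F) := fun j =>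
    LinearMap.funLeft F F fun a => ⟨j, a⟩
  have hπ : ∀ j v, π j (Matrix.toLin' (Matrix.blockDiagonal' B) v) =
      Matrix.toLin' (B j) (π j v) := fun j v => by
    ext a
    exact blockDiagonal'_mulVec_apply B v j a
  have hzero : ∀ v, v = 0 ↔ ∀ j, π j v = 0 := fun v =>
    ⟨fun h j => by rw [h, map_zero], fun h => by
      ext ⟨j, a⟩; exact congrFun (h j) a⟩
  rw [hzero]
  refine forall_congr' fun j => ?_
  rw [← hg, map_sum, Finset.sum_eq_single j]
  · rw [aeval_apply_of_intertwines (π j) (hπ j)]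
    have : π j (fun x => (Pi.single j (g j) : ∀ j, Fin (d j) → F) x.1 x.2) = g j := by
      ext a
      change (Pi.single j (g j) : ∀ j, Fin (d j) → F) j a = _
      rw [Pi.single_eq_same]
    rw [this]
  · intro i _ hi
    rw [aeval_apply_of_intertwines (π j) (hπ j)]
    have : π j (fun x => (Pi.single i (g i) : ∀ j, Fin (d j) → F) x.1 x.2) = 0 := by
      ext a
      change (Pi.single i (g i) : ∀ j, Fin (d j) → F) j a = _
      rw [Pi.single_eq_of_ne hi.symm]
    rw [this, map_zero]
  · simp

theorem IsCyclicFamily.map {V W ι : Type*} [Fintype ι] [AddCommGroup V] [Module F V]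
    [AddCommGroup W] [Module F W] {M : Module.End F V} {T : Module.End F W} {e : ι → V}
    {q : ι → F[X]} (h : IsCyclicFamily M e q) (φ : V ≃ₗ[F] W) (hφ : ∀ v, φ (M v) = T (φ v)) :
    IsCyclicFamily T (fun i => φ (e i)) q := by
  intro f
  rw [← h f, ← φ.map_eq_zero_iff, map_sum]
  refine Eq.congr_left (Finset.sum_congr rfl fun i _ => ?_)
  exact (aeval_apply_of_intertwines φ.toLinearMap hφ (f i) (e i)).symm

/-- A matrix that is similar to blocks with cyclic vectors has a cyclic family. -/
theorem IsSimilarToBlocks.exists_isCyclicFamily (h : IsSimilarToBlocks B A) {q : Fin r → F[X]}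
    (hg : ∀ i, ∃ g, ∀ f, aeval (Matrix.toLin' (B i)) f g = 0 ↔ q i ∣ f) :
    ∃ e, IsCyclicFamily (Matrix.toLin' A) e q := by
  choose g hg using hg
  obtain ⟨φ, hφ⟩ := (isSimilarToBlocks_iff B A).1 h
  exact ⟨_, (isCyclicFamily_blockDiagonal' hg).map φ hφ⟩

/-- A matrix is similar to a block diagonal matrix with blocks of a given kind, provided that
multiplication by `X` on `F[X] ⧸ (p ^ k)` is represented by such a block for all irreducible `p`
and all `k > 0`. -/
theorem exists_isSimilarToBlocks {β : Type*} (size : β → ℕ)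
    (matrix : ∀ b, Matrix (Fin (size b)) (Fin (size b)) F)
    (hβ : ∀ (p : F[X]) (k : ℕ), Irreducible p → 0 < k → ∃ (b : β) (q : F[X]),
      Associated (p ^ k) q ∧ q.natDegree = size b ∧
        ∃ g, ∀ f, aeval (Matrix.toLin' (matrix b)) f g = 0 ↔ q ∣ f)
    (A : Matrix (Fin n) (Fin n) F) :
    ∃ (r : ℕ) (J : Fin r → β), IsSimilarToBlocks (fun i => matrix (J i)) A := by
  obtain ⟨r, p, k, e, hp, hk, he, hs⟩ := exists_isCyclicFamily (Matrix.toLin' A)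
  choose J q hq hd g hg using fun i => hβ (p i) (k i) (hp i) (hk i)
  refine ⟨r, J, (isSimilarToBlocks_iff _ _).2 ?_⟩
  have hcyc := isCyclicFamily_blockDiagonal' hg
  refine hcyc.exists_linearEquiv (fun i => (hq i).symm) he (hcyc.surjective (fun i h0 => ?_) ?_) hs
  · have := hq i
    rw [h0, associated_zero_iff_eq_zero] at this
    exact pow_ne_zero _ (hp i).ne_zero this
  · simp [hd]

end CyclicBlocks

section JordanForm

theorem ComplexJordanBlock.exists_generator (b : ComplexJordanBlock) :
    ∃ g, ∀ f, aeval (Matrix.toLin' b.matrix) f g = 0 ↔ (X - C b.eigenvalue) ^ b.size ∣ f :=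
  jordanMatrix_exists_generator _ _

namespace RealJordanBlock

/-- The monic irreducible polynomial whose complex roots are the eigenvalues of the block. -/
noncomputable def basePoly : RealJordanBlock → ℝ[X]
  | real x _ _ => X - C x
  | nonreal c s _ _ _ => conjPairPoly c s

/-- The exponent to which the base polynomial occurs in the characteristic polynomial of the
block. -/
def exponent : RealJordanBlock → ℕ
  | real _ k _ => k
  | nonreal _ _ _ k _ => k

theorem exponent_pos (b : RealJordanBlock) : 0 < b.exponent := by
  cases b <;> assumption

theorem basePoly_monic (b : RealJordanBlock) : b.basePoly.Monic := by
  cases b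
  · exact monic_X_sub_C _
  · exact conjPairPoly_monic _ _

theorem basePoly_irreducible (b : RealJordanBlock) : Irreducible b.basePoly := by
  cases b with
  | real x k hk => exact irreducible_X_sub_C _
  | nonreal c s hs k hk => exact conjPairPoly_irreducible hs

theorem natDegree_basePoly_pow (b : RealJordanBlock) :
    (b.basePoly ^ b.exponent).natDegree = b.size := by
  rw [natDegree_pow]
  cases b <;> simp [basePoly, exponent, size, conjPairPoly_natDegree]

theorem isFor_iff (b : RealJordanBlock) (x : ℂ) : b.IsFor x ↔ aeval x b.basePoly = 0 := by
  cases b with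
  | real y k hk => simp [IsFor, basePoly, sub_eq_zero]
  | nonreal c s hs k hk => exact (aeval_conjPairPoly c s x).symm

theorem exists_generator (b : RealJordanBlock) :
    ∃ g, ∀ f, aeval (Matrix.toLin' b.matrix) f g = 0 ↔ b.basePoly ^ b.exponent ∣ f := by
  cases b with
  | real x k hk => exact jordanMatrix_exists_generator x k
  | nonreal c s hs k hk => exact rotationJordanMatrix_exists_generator hs k

/-- Up to units, the base polynomials are all the irreducible real polynomials. -/
theorem exists_basePoly_associated {p : ℝ[X]} (hp : Irreducible p) {k : ℕ} (hk : 0 < k) :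
    ∃ b : RealJordanBlock, Associated p b.basePoly ∧ b.exponent = k := by
  obtain ⟨z, hz⟩ := IsAlgClosed.exists_aeval_eq_zero ℂ p hp.degree_pos.ne'
  suffices h : ∃ b : RealJordanBlock, b.basePoly ∣ p ∧ b.exponent = k by
    obtain ⟨b, hb, hk⟩ := h
    exact ⟨b, (b.basePoly_irreducible.associated_of_dvd hp hb).symm, hk⟩
  by_cases him : z.im = 0
  · refine ⟨real z.re k hk, ?_, rfl⟩
    have hre : z = algebraMap ℝ ℂ z.re := Complex.ext rfl (by simpa using him)
    rw [hre, aeval_algebraMap_apply] at hz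
    exact dvd_iff_isRoot.2 (by simpa using hz)
  · refine ⟨nonreal z.re z.im him k hk, ?_, rfl⟩
    have h := quadratic_dvd_of_aeval_eq_zero_im_ne_zero p hz him
    rw [← Complex.normSq_eq_norm_sq, Complex.normSq_apply, ← sq, ← sq] at h
    rw [basePoly, conjPairPoly_eq]
    exact h

end RealJordanBlock

theorem exists_complex_jordanForm {n : ℕ} (A : Matrix (Fin n) (Fin n) ℂ) :
    ∃ (r : ℕ) (J : Fin r → ComplexJordanBlock), ComplexJordanBlock.IsJordanForm J A := by
  refine exists_isSimilarToBlocks ComplexJordanBlock.size ComplexJordanBlock.matrix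
    (fun p k hp hk => ?_) A
  obtain ⟨z, hz⟩ := IsAlgClosed.exists_root p hp.degree_pos.ne'
  refine ⟨⟨z, k, hk⟩, (X - C z) ^ k, ?_, by simp, ComplexJordanBlock.exists_generator ⟨z, k, hk⟩⟩
  exact (((irreducible_X_sub_C z).associated_of_dvd hp (dvd_iff_isRoot.2 hz)).symm).pow_pow

theorem exists_real_jordanForm {n : ℕ} (A : Matrix (Fin n) (Fin n) ℝ) :
    ∃ (r : ℕ) (J : Fin r → RealJordanBlock), RealJordanBlock.IsJordanForm J A := by
  refine exists_isSimilarToBlocks RealJordanBlock.size RealJordanBlock.matrix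
    (fun p k hp hk => ?_) A
  obtain ⟨b, hb, rfl⟩ := RealJordanBlock.exists_basePoly_associated hp hk
  exact ⟨b, _, hb.pow_pow, b.natDegree_basePoly_pow, b.exists_generator⟩

end JordanForm

/-! ### Diagonalization by rank-one perturbations -/

section Perturbation

variable {F : Type*} [Field F]

theorem natDegree_lagrange_nodal_erase {D : ℕ} {i : ℕ} (hi : i ∈ Finset.range D) :
    (Lagrange.nodal ((Finset.range D).erase i) (fun a : ℕ => (a : F))).natDegree = D - 1 := by
  rw [Lagrange.natDegree_nodal, Finset.card_erase_of_mem hi, Finset.card_range]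

theorem lagrange_basis_eq_C_mul_nodal_erase (s : Finset ℕ) (v : ℕ → F) (i : ℕ) :
    ∃ w, Lagrange.basis s v i = C w * Lagrange.nodal (s.erase i) v := by
  refine ⟨∏ j ∈ s.erase i, (v i - v j)⁻¹, ?_⟩
  simp only [Lagrange.basis, Lagrange.basisDivisor, Lagrange.nodal, Finset.prod_mul_distrib,
    map_prod]

variable [CharZero F] {V : Type*} [AddCommGroup V] [Module F V]

/-- Changing the last column of a companion matrix turns its characteristic polynomial into
`X (X - 1) ⋯ (X - D + 1)`, which has simple roots; hence one rank-one perturbation for each cyclic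
summand makes an endomorphism diagonalizable. Summands for which `s` holds consist of eigenvectors
and are not perturbed. -/
theorem exists_span_eigenvectors_eq_top {J : Type*} [Fintype J] [DecidableEq J] {D : J → ℕ}
    (M : Module.End F V) (E : J → V) (b : Module.Basis (Σ j, Fin (D j)) F V)
    (hb : ∀ j a, b ⟨j, a⟩ = (M ^ (a : ℕ)) (E j)) (s : J → Prop)
    (hs : ∀ j, s j → D j ≤ 1 ∧ ∃ μ : F, M (E j) = μ • E j) :
    ∃ (u : J → V) (φ : J → V →ₗ[F] F), (∀ j, s j → u j = 0) ∧
      Submodule.span F {v | ∃ μ : F, (M + ∑ j, (φ j).smulRight (u j)) v = μ • v} = ⊤ := by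
  classical
  let nod : J → F[X] := fun j => Lagrange.nodal (Finset.range (D j)) (fun a : ℕ => (a : F))
  let u : J → V := fun j => if s j then 0 else -aeval M (nod j) (E j)
  -- `φ j` reads off the coefficient of the highest power of `M` in the `j`-th summand
  let φ : J → V →ₗ[F] F := fun j =>
    b.constr F fun x => if x.1 = j ∧ (x.2 : ℕ) + 1 = D j then 1 else 0
  refine ⟨u, φ, fun j hj => if_pos hj, ?_⟩
  set T := M + ∑ j, (φ j).smulRight (u j) with hT
  have hTapply : ∀ v, T v = M v + ∑ j, φ j v • u j := fun v => by simp [hT]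
  have hφb : ∀ j' j (a : Fin (D j)), φ j' ((M ^ (a : ℕ)) (E j)) =
      if j = j' ∧ (a : ℕ) + 1 = D j' then 1 else 0 := by
    intro j' j a
    rw [← hb]
    exact b.constr_basis F _ _
  have hφ : ∀ j' j (f : F[X]), f.natDegree < D j →
      φ j' (aeval M f (E j)) = if j = j' then f.coeff (D j - 1) else 0 := by
    intro j' j f hf
    have h1 : aeval M f (E j) = ∑ a : Fin (D j), f.coeff a • (M ^ (a : ℕ)) (E j) := by
      conv_lhs => rw [f.as_sum_range' (D j) hf]
      rw [← Fin.sum_univ_eq_sum_range (fun a => monomial a (f.coeff a))]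
      simp [aeval_monomial, Module.algebraMap_end_apply]
    rw [h1, map_sum]
    simp only [map_smul, hφb, smul_eq_mul]
    split_ifs with h
    · subst h
      rw [Finset.sum_eq_single ⟨D j - 1, by omega⟩]
      · simp; omega
      · intro a _ ha
        rw [if_neg, mul_zero]
        rintro ⟨-, h⟩
        exact ha (Fin.ext (by simp; omega))
      · simp
    · simp [h]
  rw [eq_top_iff, ← b.span_eq, Submodule.span_le]
  rintro _ ⟨⟨j, a⟩, rfl⟩
  rw [hb]
  have hD : 0 < D j := a.pos
  by_cases hj : s j
  · obtain ⟨h1, μ, hμ⟩ := hs j hj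
    have ha : (a : ℕ) = 0 := by omega
    refine Submodule.subset_span ⟨μ, ?_⟩
    rw [ha, pow_zero, Module.End.one_apply, hTapply, hμ, add_eq_left]
    refine Finset.sum_eq_zero fun j' _ => ?_
    by_cases hjj : j = j'
    · subst hjj; simp [u, hj]
    · have := hφ j' j 1 (by simpa using hD)
      simp only [map_one, Module.End.one_apply, if_neg hjj] at this
      rw [this, zero_smul]
  · -- the Lagrange basis polynomials, evaluated at `M`, yield eigenvectors
    have heig : ∀ i ∈ Finset.range (D j), aeval M (Lagrange.nodal ((Finset.range (D j)).erase i)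
        (fun a : ℕ => (a : F))) (E j) ∈
          {v | ∃ μ : F, T v = μ • v} := by
      intro i hi
      refine ⟨i, ?_⟩
      set g := Lagrange.nodal ((Finset.range (D j)).erase i) (fun a : ℕ => (a : F)) with hg
      have hgd : g.natDegree = D j - 1 := natDegree_lagrange_nodal_erase hi
      have hgc : g.coeff (D j - 1) = 1 := by
        rw [← hgd]; exact Lagrange.nodal_monic
      have hn : nod j = (X - C (i : F)) * g :=
        Lagrange.nodal_eq_mul_nodal_erase (v := fun a : ℕ => (a : F)) hi
      rw [hTapply, Finset.sum_eq_single j]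
      · rw [hφ j j g (by omega), if_pos rfl, hgc, one_smul]
        simp only [u, if_neg hj, hn, map_mul, map_sub, aeval_X, aeval_C, Module.End.mul_apply,
          LinearMap.sub_apply, Module.algebraMap_end_apply]
        abel
      · intro j' _ hjj
        rw [hφ j' j g (by omega), if_neg hjj.symm, zero_smul]
      · simp
    have hX : (X ^ (a : ℕ) : F[X]) = Lagrange.interpolate (Finset.range (D j))
        (fun a : ℕ => (a : F)) (fun i => eval (i : F) (X ^ (a : ℕ))) := by
      refine Lagrange.eq_interpolate (fun x _ y _ h => Nat.cast_injective h) ?_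
      rw [degree_X_pow, Finset.card_range]
      exact_mod_cast a.2
    have hM : (M ^ (a : ℕ)) (E j) = aeval M (X ^ (a : ℕ) : F[X]) (E j) := by simp
    rw [hM, hX, Lagrange.interpolate_apply, map_sum, LinearMap.sum_apply]
    refine Submodule.sum_mem _ fun i hi => ?_
    obtain ⟨w, hw⟩ := lagrange_basis_eq_C_mul_nodal_erase (F := F) (Finset.range (D j))
      (fun a : ℕ => (a : F)) i
    rw [hw]
    simp only [map_mul, aeval_C, Module.End.mul_apply, Module.algebraMap_end_apply]
    exact Submodule.smul_mem _ _ (Submodule.smul_mem _ _ (Submodule.subset_span (heig i hi)))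

end Perturbation

section MatrixPerturbation

variable {F : Type*} [Field F] {n : ℕ}

theorem exists_diagonal_of_span_eigenvectors_eq_top (A : Matrix (Fin n) (Fin n) F)
    (h : Submodule.span F {v | ∃ μ : F, Matrix.toLin' A v = μ • v} = ⊤) :
    ∃ P : GL (Fin n) F, ∀ i j, i ≠ j → (P.1 * A * (P⁻¹ : GL (Fin n) F).1) i j = 0 := by
  let b₀ := Module.Basis.ofSpan h.ge
  have hcard : Module.finrank F (Fin n → F) = n := by simp
  let b := b₀.reindex (Finite.equivFinOfCardEq
    ((Module.finrank_eq_nat_card_basis b₀).symm.trans hcard))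
  have hb : ∀ j, ∃ μ : F, Matrix.toLin' A (b j) = μ • b j := fun j =>
    Module.Basis.ofSpan_subset h.ge ⟨_, (b₀.reindex_apply _ j).symm⟩
  let P : GL (Fin n) F := ⟨LinearMap.toMatrix' b.equivFun.toLinearMap,
    LinearMap.toMatrix' b.equivFun.symm.toLinearMap,
    by rw [← LinearMap.toMatrix'_comp]; simp, by rw [← LinearMap.toMatrix'_comp]; simp⟩
  refine ⟨P, fun i j hij => ?_⟩
  have h1 : P.1 * A * (P⁻¹ : GL (Fin n) F).1 = LinearMap.toMatrix'
      (b.equivFun.toLinearMap ∘ₗ Matrix.toLin' A ∘ₗ b.equivFun.symm.toLinearMap) := by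
    rw [LinearMap.toMatrix'_comp, LinearMap.toMatrix'_comp, LinearMap.toMatrix'_toLin',
      Matrix.mul_assoc]
    rfl
  obtain ⟨μ, hμ⟩ := hb j
  have h2 : b.equivFun.symm (Pi.single j 1) = b j := by
    rw [LinearEquiv.symm_apply_eq]; ext k; simp [Pi.single_apply, eq_comm]
  rw [h1, LinearMap.toMatrix'_apply]
  simp only [LinearMap.comp_apply, LinearEquiv.coe_coe, h2, hμ, map_smul]
  simp [hij]

theorem toLin'_vecMulVec (u w : Fin n → F) (φ : (Fin n → F) →ₗ[F] F)
    (hw : ∀ k, w k = φ (Pi.single k 1)) :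
    Matrix.toLin' (Matrix.vecMulVec u w) = φ.smulRight u := by
  apply LinearMap.toMatrix'.injective
  rw [LinearMap.toMatrix'_toLin']
  ext i k
  simp [LinearMap.toMatrix'_apply, Matrix.vecMulVec_apply, hw, mul_comm]

/-- Elements of a finite type can be coloured with `m` colours so that equivalent elements get
different colours, if all classes have at most `m` elements. -/
theorem exists_coloring {ι κ : Type*} [Finite ι] (t : ι → κ) (m : ℕ)
    (h : ∀ x, Nat.card {i // t i = x} ≤ m) :
    ∃ c : ι → Fin m, ∀ i i', t i = t i' → c i = c i' → i = i' := by
  have hemb : ∀ x, Nonempty ({i // t i = x} ↪ Fin m) := fun x => by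
    have := Fintype.ofFinite {i // t i = x}
    refine Function.Embedding.nonempty_of_card_le ?_
    simpa [Nat.card_eq_fintype_card] using h x
  let emb := fun x => (hemb x).some
  refine ⟨fun i => emb (t i) ⟨i, rfl⟩, fun i i' ht hc => ?_⟩
  have : ∀ x (hx : t i' = x), emb (t i') ⟨i', rfl⟩ = emb x ⟨i', hx⟩ := by
    rintro _ rfl; rfl
  change emb (t i) ⟨i, rfl⟩ = emb (t i') ⟨i', rfl⟩ at hc
  rw [this _ ht.symm] at hc
  exact congrArg Subtype.val ((emb (t i)).injective hc)

variable {r : ℕ} [CharZero F]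

/-- Suppose that each irreducible `p i₀` occurs in at most `m` annihilators `p i ^ k i` of degree at
least `2`. Then these annihilators can be distributed to `m` colours such that those of the same
colour are coprime; one rank-one perturbation for each colour makes `A` diagonalizable. -/
theorem IsCyclicFamily.exists_diagonalizable_add {A : Matrix (Fin n) (Fin n) F}
    {e : Fin r → Fin n → F} {p : Fin r → F[X]} {k : Fin r → ℕ}
    (h : IsCyclicFamily (Matrix.toLin' A) e fun i => p i ^ k i)
    (hp : ∀ i, Irreducible (p i)) (hmonic : ∀ i, (p i).Monic)
    (hk : ∀ i, 0 < k i) (hdim : ∑ i, (p i ^ k i).natDegree = n) {m : ℕ}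
    (hm : ∀ i₀, Nat.card {i // p i = p i₀ ∧ 2 ≤ (p i ^ k i).natDegree} ≤ m) :
    ∃ (u w : Fin m → Fin n → F) (P : GL (Fin n) F), ∀ i j, i ≠ j →
      (P.1 * (A + ∑ l, Matrix.vecMulVec (u l) (w l)) * (P⁻¹ : GL (Fin n) F).1) i j = 0 := by
  classical
  let bad : Fin r → Prop := fun i => 2 ≤ (p i ^ k i).natDegree
  obtain ⟨c₀, hc₀⟩ : ∃ c : {i // bad i} → Fin m,
      ∀ i i', p i.1 = p i'.1 → c i = c i' → i = i' := by
    refine exists_coloring (fun i : {i // bad i} => p i.1) m fun x => ?_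
    by_cases hx : ∃ i₀, p i₀ = x
    · obtain ⟨i₀, rfl⟩ := hx
      refine le_trans (Nat.card_le_card_of_injective
        (fun y => ⟨y.1.1, y.2, y.1.2⟩) fun y y' hy => ?_) (hm i₀)
      exact Subtype.ext (Subtype.ext (by simpa using hy))
    · have : IsEmpty {i : {i // bad i} // p i.1 = x} := ⟨fun y => hx ⟨_, y.2⟩⟩
      simp
  -- blocks of size `1` get colours of their own
  let c : Fin r → Fin m ⊕ Fin r := fun i => if hi : bad i then .inl (c₀ ⟨i, hi⟩) else .inr i
  have hc_inr : ∀ i i', c i' = .inr i → i' = i ∧ ¬ bad i := by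
    intro i i' h
    by_cases hi : bad i'
    · simp [c, hi] at h
    · simp only [c, hi, dite_false, Sum.inr.injEq] at h
      exact ⟨h, h ▸ hi⟩
  have hcop : ∀ i i', i ≠ i' → c i = c i' → IsCoprime (p i ^ k i) (p i' ^ k i') := by
    intro i i' hne hcc
    by_cases hi' : bad i'
    · have hi : bad i := by
        by_contra hi
        simp [c, hi, hi'] at hcc
      simp only [c, hi, hi', dite_true, Sum.inl.injEq] at hcc
      refine IsCoprime.pow ((hp i).coprime_iff_not_dvd.2 fun hd => hne ?_)
      have := eq_of_monic_of_associated (hmonic i) (hmonic i')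
        ((hp i).associated_of_dvd (hp i') hd)
      exact congrArg Subtype.val (hc₀ ⟨i, hi⟩ ⟨i', hi'⟩ this hcc)
    · have : c i' = .inr i' := by simp [c, hi']
      exact absurd (hc_inr i' i (hcc.trans this)).1 hne
  have hne0 : ∀ i, p i ^ k i ≠ 0 := fun i => pow_ne_zero _ (hp i).ne_zero
  obtain ⟨b, hb⟩ := h.exists_basis hne0 (by simpa using hdim) c hcop
  obtain ⟨u, φ, hu, hspan⟩ := exists_span_eigenvectors_eq_top (Matrix.toLin' A)
    (fun j => ∑ i with c i = j, e i) b hb (fun j => j.isRight) (by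
      rintro (l | i) hj
      · simp at hj
      by_cases hi : bad i
      · have hempty : (Finset.univ.filter fun i' => c i' = Sum.inr i) = ∅ :=
          Finset.filter_eq_empty_iff.2 fun i' _ hi' => (hc_inr i i' hi').2 hi
        simp [hempty]
      · have hsing : (Finset.univ.filter fun i' => c i' = Sum.inr i) = {i} := by
          ext i'
          simp only [Finset.mem_filter, Finset.mem_univ, true_and, Finset.mem_singleton]
          exact ⟨fun hi' => (hc_inr i i' hi').1, fun hi' => by subst hi'; simp [c, hi]⟩
        have hdeg : (p i ^ k i).natDegree ≤ 1 := by
          have : ¬ 2 ≤ (p i ^ k i).natDegree := hi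
          omega
        rw [hsing, Finset.sum_singleton, Finset.sum_singleton]
        refine ⟨hdeg, ?_⟩
        have h0 := h.aeval_self i
        have hpos : 0 < (p i ^ k i).natDegree := by
          rw [natDegree_pow]
          exact Nat.mul_pos (hk i) (hp i).natDegree_pos
        have hm1 : (p i ^ k i).Monic := (hmonic i).pow _
        rw [hm1.eq_X_add_C (by omega)] at h0
        refine ⟨-(p i ^ k i).coeff 0, ?_⟩
        simp only [map_add, aeval_X, aeval_C, LinearMap.add_apply,
          Module.algebraMap_end_apply] at h0
        rw [neg_smul]
        exact eq_neg_of_add_eq_zero_left h0)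
  let w : Fin m → Fin n → F := fun l a => φ (.inl l) (Pi.single a 1)
  obtain ⟨P, hP⟩ := exists_diagonal_of_span_eigenvectors_eq_top
    (A + ∑ l, Matrix.vecMulVec (u (.inl l)) (w l)) (by
      rw [← hspan]
      have h1 : Matrix.toLin' (A + ∑ l, Matrix.vecMulVec (u (.inl l)) (w l)) =
          Matrix.toLin' A + ∑ j, (φ j).smulRight (u j) := by
        rw [map_add, map_sum, Fintype.sum_sum_type,
          Finset.sum_eq_zero (s := (Finset.univ : Finset (Fin r))), add_zero]
        · congr 1
          exact Finset.sum_congr rfl fun l _ => toLin'_vecMulVec _ _ (φ (.inl l)) fun _ => rfl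
        · intro i _
          rw [hu (.inr i) rfl, LinearMap.smulRight_zero]
      rw [h1])
  exact ⟨fun l => u (.inl l), w, P, hP⟩

end MatrixPerturbation

/-! ### The lower bound for the rank -/

section LowerBound

theorem finrank_map_add_finrank_inf_ker {F V W : Type*} [Field F] [AddCommGroup V] [Module F V]
    [FiniteDimensional F V] [AddCommGroup W] [Module F W] (f : V →ₗ[F] W) (S : Submodule F V) :
    Module.finrank F (S.map f) + Module.finrank F (S ⊓ LinearMap.ker f : Submodule F V) =
      Module.finrank F S := by
  rw [← (f.domRestrict S).finrank_range_add_finrank_ker, LinearMap.range_domRestrict]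
  congr 1
  rw [LinearMap.ker_domRestrict, ← Submodule.map_comap_subtype]
  exact Submodule.finrank_map_subtype_eq _ _

/-- The dimension count behind the lower bound. A rank decomposition of `(1; A)` of length
`dim W` factors the identity as `U ∘ H` and `A - z` as `U ∘ G`. On a space `K` of eigenvectors `G`
takes values in `ker U ⊓ ker Q`. Where `G` vanishes on `K`, an eigenvector `v = U (G w)` gives
`H v - G w ∈ ker U`, whose image under `Q` is `H v`. Together this bounds `dim K` by
`dim (ker U) = dim W - dim V`. -/
theorem finrank_add_finrank_le_of_factorization {F V W : Type*} [Field F] [AddCommGroup V]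
    [Module F V] [FiniteDimensional F V] [AddCommGroup W] [Module F W] [FiniteDimensional F W]
    {U : W →ₗ[F] V} {G H : V →ₗ[F] W} {Q : W →ₗ[F] W} (hUH : ∀ v, U (H v) = v)
    (hQG : ∀ v, Q (G v) = 0) (hQH : ∀ v, G v = 0 → Q (H v) = H v) {K : Submodule F V}
    (hK : ∀ v ∈ K, U (G v) = 0) (hrange : ∀ v ∈ K, G v = 0 → ∃ w, U (G w) = v) :
    Module.finrank F K + Module.finrank F V ≤ Module.finrank F W := by
  have hU : LinearMap.range U = ⊤ := LinearMap.range_eq_top.2 fun v => ⟨H v, hUH v⟩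
  have h1 := U.finrank_range_add_finrank_ker
  rw [hU, finrank_top] at h1
  have h2 := finrank_map_add_finrank_inf_ker G K
  have h3 := finrank_map_add_finrank_inf_ker Q (LinearMap.ker U)
  have h4 : Module.finrank F (K.map G) ≤
      Module.finrank F (LinearMap.ker U ⊓ LinearMap.ker Q : Submodule F W) := by
    refine Submodule.finrank_mono ?_
    rintro _ ⟨v, hv, rfl⟩
    exact ⟨hK v hv, hQG v⟩
  have h5 : Module.finrank F (K ⊓ LinearMap.ker G : Submodule F V) ≤
      Module.finrank F ((LinearMap.ker U).map Q) := by
    have hH : Function.Injective H := Function.LeftInverse.injective hUH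
    rw [(Submodule.equivMapOfInjective H hH (K ⊓ LinearMap.ker G)).finrank_eq]
    refine Submodule.finrank_mono ?_
    rintro _ ⟨v, ⟨hv, hGv⟩, rfl⟩
    obtain ⟨w, hw⟩ := hrange v hv hGv
    refine ⟨H v - G w, ?_, ?_⟩
    · change U (H v - G w) = 0
      rw [map_sub, hUH, hw, sub_self]
    · rw [map_sub, hQG, sub_zero, hQH v hGv]
  omega

variable {F : Type*} [Field F] {n R : ℕ}

/-- A rank decomposition of `(1; A)` is long if `A` has a large space `K` of eigenvectors. The
hypothesis `hrange` concerns the eigenvectors that are annihilated by all terms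
`(c j 1 - z * c j 0) • b j` of `A - z`. -/
theorem finrank_add_le_of_decomposition {A : Matrix (Fin n) (Fin n) F} {a b : Fin R → Fin n → F}
    {c : Fin R → Fin 2 → F} (h0 : ∑ j, c j 0 • Matrix.vecMulVec (a j) (b j) = 1)
    (h1 : ∑ j, c j 1 • Matrix.vecMulVec (a j) (b j) = A) (z : F)
    {K : Submodule F (Fin n → F)} (hK : ∀ v ∈ K, A.mulVec v = z • v)
    (hrange : ∀ v ∈ K, (∀ j, (c j 1 - z * c j 0) * (b j ⬝ᵥ v) = 0) →
      ∃ w, A.mulVec w - z • w = v) :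
    n + Module.finrank F K ≤ R := by
  classical
  let U := Matrix.toLin' (Matrix.of fun i j => a j i)
  let H : (Fin n → F) →ₗ[F] (Fin R → F) := Matrix.toLin' (Matrix.of fun j i => c j 0 * b j i)
  let G : (Fin n → F) →ₗ[F] (Fin R → F) :=
    Matrix.toLin' (Matrix.of fun j i => (c j 1 - z * c j 0) * b j i)
  let Q : (Fin R → F) →ₗ[F] (Fin R → F) :=
    Matrix.toLin' (Matrix.diagonal fun j => if c j 1 - z * c j 0 = 0 then 1 else 0)
  have hH : ∀ v j, H v j = c j 0 * (b j ⬝ᵥ v) := fun v j => by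
    simp [H, Matrix.mulVec, dotProduct, Finset.mul_sum, mul_assoc]
  have hG : ∀ v j, G v j = (c j 1 - z * c j 0) * (b j ⬝ᵥ v) := fun v j => by
    simp [G, Matrix.mulVec, dotProduct, Finset.mul_sum, mul_assoc]
  have hQ : ∀ x j, Q x j = (if c j 1 - z * c j 0 = 0 then 1 else 0) * x j := fun x j => by
    simp [Q, Matrix.mulVec_diagonal]
  have hU : ∀ (t : Fin R → F) v, U (fun j => t j * (b j ⬝ᵥ v)) =
      (∑ j, t j • Matrix.vecMulVec (a j) (b j)).mulVec v := fun t v => by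
    ext i
    simp only [U, Matrix.toLin'_apply, Matrix.mulVec, dotProduct, Matrix.of_apply,
      Matrix.sum_apply, Matrix.smul_apply, Matrix.vecMulVec_apply, smul_eq_mul, Finset.mul_sum,
      Finset.sum_mul]
    rw [Finset.sum_comm]
    exact Finset.sum_congr rfl fun _ _ => Finset.sum_congr rfl fun _ _ => by ring
  have hUH : ∀ v, U (H v) = v := fun v => by
    rw [show H v = fun j => c j 0 * (b j ⬝ᵥ v) from funext (hH v), hU, h0, Matrix.one_mulVec]
  have hUG : ∀ v, U (G v) = A.mulVec v - z • v := fun v => by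
    rw [show G v = fun j => (c j 1 - z * c j 0) * (b j ⬝ᵥ v) from funext (hG v),
      hU (fun j => c j 1 - z * c j 0)]
    simp only [sub_smul, mul_smul, Finset.sum_sub_distrib, ← Finset.smul_sum, h0, h1,
      Matrix.sub_mulVec, Matrix.smul_mulVec, Matrix.one_mulVec]
  have := finrank_add_finrank_le_of_factorization (U := U) (G := G) (H := H) (Q := Q) hUH
    (fun v => by
      ext j
      rw [hQ, hG]
      split_ifs with h <;> simp [h])
    (fun v hv => by
      ext j
      have hj := congrFun hv j
      rw [hG] at hj
      rw [hQ, hH]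
      split_ifs with h
      · rw [one_mul]
      · rcases mul_eq_zero.1 hj with hj | hj
        · exact absurd hj h
        · simp [hj])
    (K := K) (fun v hv => by rw [hUG, hK v hv, sub_self])
    (fun v hv hGv => by
      obtain ⟨w, hw⟩ := hrange v hv fun j => by rw [← hG, hGv]; rfl
      exact ⟨w, by rw [hUG, hw]⟩)
  simpa [add_comm] using this

theorem IsSumOfPureTensors.exists_eq {A : Matrix (Fin n) (Fin n) F}
    (h : IsSumOfPureTensors (![1, A] : TwoSliceTensor F n n) R) :
    ∃ (a b : Fin R → Fin n → F) (c : Fin R → Fin 2 → F),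
      ∑ j, c j 0 • Matrix.vecMulVec (a j) (b j) = 1 ∧
      ∑ j, c j 1 • Matrix.vecMulVec (a j) (b j) = A := by
  obtain ⟨a, b, c, h⟩ := h
  exact ⟨a, b, c, (congrFun h 0).symm, (congrFun h 1).symm⟩

/-- A subfamily of a cyclic family is cyclic. -/
theorem IsCyclicFamily.subtype {V ι : Type*} [Fintype ι] [AddCommGroup V] [Module F V]
    {M : Module.End F V} {e : ι → V} {q : ι → F[X]} (h : IsCyclicFamily M e q) (P : ι → Prop)
    [DecidablePred P] :
    IsCyclicFamily M (fun i : {i // P i} => e i) (fun i => q i) := by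
  classical
  intro f
  let g : ι → F[X] := fun i => if hi : P i then f ⟨i, hi⟩ else 0
  have hg : ∀ i : {i // P i}, g i = f i := fun i => by simp [g, i.2]
  have hsum : ∑ i, aeval M (g i) (e i) = ∑ i : {i // P i}, aeval M (f i) (e i) := by
    rw [← Fintype.sum_subtype_add_sum_subtype P]
    rw [Finset.sum_eq_zero (s := (Finset.univ : Finset {i // ¬ P i})), add_zero]
    · simp only [hg]
    · intro i _
      simp [g, i.2]
  rw [← hsum, h g]
  refine ⟨fun h i => hg i ▸ h i, fun h i => ?_⟩
  by_cases hi : P i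
  · simpa [g, hi] using h ⟨i, hi⟩
  · simp [g, hi]

/-- Jordan chains of length at least `2` for `x ∈ F` each provide an eigenvector in the range of
`A - x`. -/
theorem IsCyclicFamily.card_add_le_of_linear {ι : Type*} [Fintype ι] {A : Matrix (Fin n) (Fin n) F}
    {e : ι → Fin n → F} {x : F} {k : ι → ℕ}
    (h : IsCyclicFamily (Matrix.toLin' A) e fun i => (X - C x) ^ k i) (hk : ∀ i, 2 ≤ k i)
    (hR : IsSumOfPureTensors (![1, A] : TwoSliceTensor F n n) R) :
    n + Fintype.card ι ≤ R := by
  classical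
  obtain ⟨a, b, c, h0, h1⟩ := hR.exists_eq
  let N : Module.End F (Fin n → F) := aeval (Matrix.toLin' A) (X - C x)
  have hN : ∀ v, N v = A.mulVec v - x • v := fun v => by
    simp [N, Module.algebraMap_end_apply]
  let v : ι → Fin n → F := fun i => aeval (Matrix.toLin' A) ((X - C x) ^ (k i - 1)) (e i)
  have hv0 : ∀ i, N (v i) = 0 := fun i => by
    rw [← h.aeval_self i, ← Module.End.mul_apply, ← map_mul, ← pow_succ']
    congr 3
    have := hk i
    omega
  have hvr : ∀ i, ∃ w, N w = v i := fun i => by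
    refine ⟨aeval (Matrix.toLin' A) ((X - C x) ^ (k i - 2)) (e i), ?_⟩
    rw [← Module.End.mul_apply, ← map_mul, ← pow_succ']
    simp only [v]
    congr 3
    have := hk i
    omega
  have hli : LinearIndependent F v := by
    rw [Fintype.linearIndependent_iff]
    intro g hg i
    have := (h fun i => C (g i) * (X - C x) ^ (k i - 1)).1 (by
      rw [← hg]
      refine Finset.sum_congr rfl fun i _ => ?_
      rw [map_mul, Module.End.mul_apply, aeval_C, Module.algebraMap_end_apply]) i
    dsimp only at this
    rw [← Nat.sub_add_cancel (one_le_two.trans (hk i)), Nat.add_sub_cancel, pow_succ',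
      mul_dvd_mul_iff_right (pow_ne_zero _ (X_sub_C_ne_zero x))] at this
    by_contra hgi
    have h2 := natDegree_le_of_dvd this (C_ne_zero.2 hgi)
    simp at h2
  rw [← finrank_span_eq_card hli]
  have hle : Submodule.span F (Set.range v) ≤ LinearMap.ker N :=
    Submodule.span_le.2 (by rintro _ ⟨i, rfl⟩; exact hv0 i)
  have hle' : Submodule.span F (Set.range v) ≤ LinearMap.range N :=
    Submodule.span_le.2 (by rintro _ ⟨i, rfl⟩; exact hvr i)
  refine finrank_add_le_of_decomposition h0 h1 x (fun u hu => ?_) fun u hu _ => ?_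
  · have : N u = 0 := hle hu
    rwa [hN, sub_eq_zero] at this
  · obtain ⟨w, hw⟩ := hle' hu
    exact ⟨w, by rw [← hN, hw]⟩

/-- Over `ℝ`, all Jordan chains for a nonreal pair `c ± s i` contribute: each provides a complex
eigenvector, and the coefficients `c j 1 - z * c j 0` with real `c j` and nonreal `z` vanish only
together with `c j`. -/
theorem IsCyclicFamily.card_add_le_of_quadratic {ι : Type*} [Fintype ι]
    {A : Matrix (Fin n) (Fin n) ℝ} {e : ι → Fin n → ℝ} {c s : ℝ} (hs : s ≠ 0) {k : ι → ℕ}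
    (h : IsCyclicFamily (Matrix.toLin' A) e fun i => conjPairPoly c s ^ k i) (hk : ∀ i, 1 ≤ k i)
    (hR : IsSumOfPureTensors (![1, A] : TwoSliceTensor ℝ n n) R) :
    n + Fintype.card ι ≤ R := by
  classical
  obtain ⟨a, b, t, h0, h1⟩ := hR.exists_eq
  let z : ℂ := ⟨c, s⟩
  let A' : Matrix (Fin n) (Fin n) ℂ := A.map Complex.ofReal
  let a' : Fin R → Fin n → ℂ := fun j i => a j i
  let b' : Fin R → Fin n → ℂ := fun j i => b j i
  let t' : Fin R → Fin 2 → ℂ := fun j i => t j i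
  have h0' : ∑ j, t' j 0 • Matrix.vecMulVec (a' j) (b' j) = 1 := by
    have h2 : (1 : Matrix (Fin n) (Fin n) ℂ) = (1 : Matrix (Fin n) (Fin n) ℝ).map Complex.ofReal :=
      (Matrix.map_one _ Complex.ofReal_zero Complex.ofReal_one).symm
    rw [h2, ← h0]
    ext i j
    simp [Matrix.sum_apply, Matrix.vecMulVec_apply, t', a', b']
  have h1' : ∑ j, t' j 1 • Matrix.vecMulVec (a' j) (b' j) = A' := by
    simp only [A']
    rw [← h1]
    ext i j
    simp [Matrix.sum_apply, Matrix.vecMulVec_apply, t', a', b']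
  -- real and imaginary part of the eigenvector `(A - conj z) (p(A) ^ (k - 1)) e`
  let re : ι → Fin n → ℝ := fun i =>
    aeval (Matrix.toLin' A) ((X - C c) * conjPairPoly c s ^ (k i - 1)) (e i)
  let im : ι → Fin n → ℝ := fun i =>
    aeval (Matrix.toLin' A) (C s * conjPairPoly c s ^ (k i - 1)) (e i)
  let v : ι → Fin n → ℂ := fun i a => ⟨re i a, im i a⟩
  have hshift : ∀ f : ℝ[X], ∀ u, A.mulVec (aeval (Matrix.toLin' A) f u) =
      aeval (Matrix.toLin' A) (X * f) u := fun f u => by simp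
  have him : ∀ i, A.mulVec (im i) = s • re i + c • im i := fun i => by
    simp only [re, im]
    rw [hshift, ← LinearMap.smul_apply, ← LinearMap.smul_apply, ← map_smul, ← map_smul,
      ← LinearMap.add_apply, ← map_add, smul_eq_C_mul, smul_eq_C_mul]
    congr 2
    ring
  have hre : ∀ i, A.mulVec (re i) = c • re i - s • im i := fun i => by
    have h2 := h.aeval_self i
    have h3 : conjPairPoly c s ^ k i = conjPairPoly c s * conjPairPoly c s ^ (k i - 1) := by
      rw [← pow_succ', Nat.sub_add_cancel (hk i)]
    rw [← sub_eq_zero, ← h2, h3]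
    simp only [re, im]
    rw [hshift, ← LinearMap.smul_apply, ← LinearMap.smul_apply, ← map_smul, ← map_smul,
      ← LinearMap.sub_apply, ← LinearMap.sub_apply, ← map_sub, ← map_sub, smul_eq_C_mul,
      smul_eq_C_mul]
    congr 2
    have h4 : conjPairPoly c s = (X - C c) ^ 2 + C s ^ 2 := by rw [conjPairPoly, C_pow]
    generalize conjPairPoly c s ^ (k i - 1) = y
    rw [h4]
    ring
  have heig : ∀ i, A'.mulVec (v i) = z • v i := fun i => by
    have hmul : ∀ a, A'.mulVec (v i) a = ⟨A.mulVec (re i) a, A.mulVec (im i) a⟩ := fun a => by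
      simp only [Matrix.mulVec, dotProduct, A', v, Matrix.map_apply]
      apply Complex.ext <;> simp
    ext a
    rw [hmul, hre, him]
    apply Complex.ext
    · simp [v, z]
    · simp [v, z]; ring
  have hli : LinearIndependent ℂ v := by
    rw [Fintype.linearIndependent_iff]
    intro g hg i
    -- the real part of the relation suffices
    have h2 := (h fun i => (C (g i).re * (X - C c) - C ((g i).im * s)) *
        conjPairPoly c s ^ (k i - 1)).1 (by
      ext a
      have h3 := congrArg Complex.re (congrFun hg a)
      simp only [Finset.sum_apply, Pi.smul_apply, smul_eq_mul, Complex.re_sum, Complex.mul_re, v,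
        Pi.zero_apply, Complex.zero_re] at h3
      rw [Pi.zero_apply, ← h3, Finset.sum_apply]
      refine Finset.sum_congr rfl fun i _ => ?_
      have h4 : (C (g i).re * (X - C c) - C ((g i).im * s)) * conjPairPoly c s ^ (k i - 1) =
          (g i).re • ((X - C c) * conjPairPoly c s ^ (k i - 1)) -
          (g i).im • (C s * conjPairPoly c s ^ (k i - 1)) := by
        rw [smul_eq_C_mul, smul_eq_C_mul, C_mul]; ring
      rw [h4, map_sub, map_smul, map_smul]
      rfl) i
    dsimp only at h2
    rw [← Nat.sub_add_cancel (hk i), Nat.add_sub_cancel, pow_succ',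
      mul_dvd_mul_iff_right (pow_ne_zero _ (conjPairPoly_monic c s).ne_zero)] at h2
    have h5 := eq_zero_of_dvd_of_natDegree_lt h2 (by
      rw [conjPairPoly_natDegree]
      refine lt_of_le_of_lt (b := 1) ?_ one_lt_two
      compute_degree)
    have h6 := congrArg (fun f => coeff f 1) h5
    have h7 := congrArg (fun f => eval c f) h5
    simp [coeff_X] at h6 h7
    exact Complex.ext h6 (h7.resolve_right hs)
  rw [← finrank_span_eq_card hli]
  have hle : Submodule.span ℂ (Set.range v) ≤ LinearMap.ker (Matrix.toLin' A' - z • LinearMap.id) :=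
    Submodule.span_le.2 (by rintro _ ⟨i, rfl⟩; simp [heig])
  refine finrank_add_le_of_decomposition h0' h1' z (fun u hu => ?_) fun u hu hu0 => ?_
  · have := hle hu
    simpa [sub_eq_zero] using this
  · have ht : ∀ j, t' j 0 * (b' j ⬝ᵥ u) = 0 := fun j => by
      rcases mul_eq_zero.1 (hu0 j) with hj | hj
      · have hj' := congrArg Complex.im hj
        simp [t', z, hs] at hj'
        simp [t', hj']
      · rw [hj, mul_zero]
    have : u = 0 := by
      rw [← Matrix.one_mulVec u, ← h0', Matrix.sum_mulVec]
      refine Finset.sum_eq_zero fun j _ => ?_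
      rw [Matrix.smul_mulVec, Matrix.vecMulVec_mulVec]
      ext i
      have := ht j
      simp only [Pi.smul_apply, smul_eq_mul, MulOpposite.smul_eq_mul_unop, MulOpposite.unop_op,
        Pi.zero_apply]
      linear_combination (a' j i) * this
    exact ⟨0, by simp [this]⟩

end LowerBound

/-! ### The rank of the tensor -/

section Rank

variable {F : Type*} [Field F] {n : ℕ}

theorem isSumOfPureTensors_of_fintype {m : ℕ} {ι : Type*} [Fintype ι] {T : TwoSliceTensor F m n}
    (a : ι → Fin m → F) (b : ι → Fin n → F) (c : ι → Fin 2 → F)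
    (h : ∀ k, T k = ∑ j, c j k • Matrix.vecMulVec (a j) (b j)) :
    IsSumOfPureTensors T (Fintype.card ι) := by
  let E := (Fintype.equivFin ι).symm
  refine ⟨fun j => a (E j), fun j => b (E j), fun j => c (E j), funext fun k => ?_⟩
  rw [h, ← E.sum_comp]

theorem isSumOfPureTensors_tensorRank {m : ℕ} (T : TwoSliceTensor F m n) :
    IsSumOfPureTensors T (tensorRank T) :=
  Nat.sInf_mem (exists_isSumOfPureTensors T)

theorem IsSumOfPureTensors.tensorRank_le {m r : ℕ} {T : TwoSliceTensor F m n}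
    (h : IsSumOfPureTensors T r) : tensorRank T ≤ r :=
  Nat.sInf_le h

theorem tensorRank_eq_one {T : TwoSliceTensor F n n} (u w : Fin n → F) (hT : T ≠ 0)
    (h : T = ![0, Matrix.vecMulVec u w]) : tensorRank T = 1 := by
  refine le_antisymm ?_ (Nat.one_le_iff_ne_zero.2 fun h0 => hT ?_)
  · refine (isSumOfPureTensors_of_fintype (ι := Unit) (fun _ => u) (fun _ => w)
      (fun _ => ![0, 1]) fun k => ?_).tensorRank_le
    subst h
    fin_cases k <;> simp
  · have := isSumOfPureTensors_tensorRank T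
    rw [h0] at this
    obtain ⟨a, b, c, h⟩ := this
    rw [h]
    funext k
    simp

/-- If the perturbation of `A` by `m` rank-one matrices is diagonalizable, and if the rank of
`(1; A)` is at least `n + m`, then equality holds. The terms are nonzero, since omitting a zero
term would give a shorter decomposition. -/
theorem tensorRank_eq_of_diagonalizable_add {m : ℕ} {A : Matrix (Fin n) (Fin n) F}
    (hlower : ∀ R, IsSumOfPureTensors (![1, A] : TwoSliceTensor F n n) R → n + m ≤ R)
    (hupper : ∃ (u w : Fin m → Fin n → F) (P : GL (Fin n) F), ∀ i j, i ≠ j →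
      (P.1 * (A + ∑ l, Matrix.vecMulVec (u l) (w l)) * (P⁻¹ : GL (Fin n) F).1) i j = 0) :
    tensorRank (![1, A] : TwoSliceTensor F n n) = n + m ∧
      ∃ T : Fin m → TwoSliceTensor F n n, (∀ i, tensorRank (T i) = 1) ∧
        IsDiagonalizableTensor ((![1, A] : TwoSliceTensor F n n) + ∑ i, T i) := by
  classical
  obtain ⟨u, w, P, hP⟩ := hupper
  set A' := A + ∑ l, Matrix.vecMulVec (u l) (w l) with hA'
  let P' : Matrix (Fin n) (Fin n) F := (P⁻¹ : GL (Fin n) F).1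
  have hPP : P' * P.1 = 1 := by rw [← Units.val_mul, inv_mul_cancel, Units.val_one]
  let D : Matrix (Fin n) (Fin n) F := P.1 * A' * P'
  have hD : D = Matrix.diagonal fun j => D j j := by
    ext i j
    by_cases hij : i = j
    · subst hij; simp
    · rw [Matrix.diagonal_apply_ne _ hij]; exact hP i j hij
  have hdecomp : ∀ δ : Fin n → F, P' * Matrix.diagonal δ * P.1 =
      ∑ j, δ j • Matrix.vecMulVec (fun i => P' i j) (fun i => P.1 j i) := fun δ => by
    ext i k
    rw [Matrix.mul_apply]
    simp only [Matrix.mul_diagonal, Matrix.sum_apply, Matrix.smul_apply,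
      Matrix.vecMulVec_apply, smul_eq_mul]
    exact Finset.sum_congr rfl fun _ _ => by ring
  have hA'D : A' = ∑ j, D j j • Matrix.vecMulVec (fun i => P' i j) (fun i => P.1 j i) := by
    rw [← hdecomp, ← hD]
    simp only [D]
    rw [← Matrix.mul_assoc, ← Matrix.mul_assoc, hPP, Matrix.one_mul, Matrix.mul_assoc, hPP,
      Matrix.mul_one]
  have hone : 1 = ∑ j, (1 : F) • Matrix.vecMulVec (fun i => P' i j) (fun i => P.1 j i) := by
    rw [← hdecomp, ← Pi.one_def, Matrix.diagonal_one', Matrix.mul_one, hPP]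
  have hsum : ∀ S : Finset (Fin m), (∀ l, l ∉ S → Matrix.vecMulVec (u l) (w l) = 0) →
      IsSumOfPureTensors (![1, A] : TwoSliceTensor F n n) (n + S.card) := fun S hS => by
    have hAS : A = A' - ∑ l : S, Matrix.vecMulVec (u l) (w l) := by
      rw [Finset.sum_coe_sort S fun l => Matrix.vecMulVec (u l) (w l),
        Finset.sum_subset S.subset_univ fun l _ hl => hS l hl, hA', add_sub_cancel_right]
    have := isSumOfPureTensors_of_fintype (T := (![1, A] : TwoSliceTensor F n n))
      (ι := Fin n ⊕ S)
      (Sum.elim (fun j i => P' i j) fun l => u l) (Sum.elim (fun j i => P.1 j i) fun l => w l)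
      (Sum.elim (fun j => ![1, D j j]) fun _ => ![0, -1]) fun k => by
        rw [Fintype.sum_sum_type]
        fin_cases k
        · simpa using hone
        · change A = _
          rw [hAS, hA'D]
          simp [sub_eq_add_neg]
    simpa using this
  have hne : ∀ l, Matrix.vecMulVec (u l) (w l) ≠ 0 := fun l hl => by
    have h1 := hlower _ (hsum (Finset.univ.erase l) fun l' hl' => by
      have : l' = l := by simpa using hl'
      rwa [this])
    rw [Finset.card_erase_of_mem (Finset.mem_univ l), Finset.card_univ, Fintype.card_fin] at h1
    have := l.pos
    omega
  refine ⟨le_antisymm ?_ (hlower _ (isSumOfPureTensors_tensorRank _)),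
    fun l => ![0, Matrix.vecMulVec (u l) (w l)],
    fun l => tensorRank_eq_one _ _ (fun h0 => hne l (congrFun h0 1)) rfl, P, P⁻¹, ?_⟩
  · simpa using (hsum Finset.univ fun l hl => absurd (Finset.mem_univ l) hl).tensorRank_le
  · intro k i j hij
    have hij' : i ≠ j := fun h => hij (congrArg _ h)
    rw [Pi.add_apply, Finset.sum_apply]
    fin_cases k
    · simp [hij']
    · exact hP i j hij'

end Rank

section JordanRank

theorem ComplexJordanBlock.IsJordanForm.add_alpha_le {n r R : ℕ} {A : Matrix (Fin n) (Fin n) ℂ}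
    {J : Fin r → ComplexJordanBlock} (hJ : IsJordanForm J A) (x : ℂ)
    (hR : IsSumOfPureTensors (![1, A] : TwoSliceTensor ℂ n n) R) : n + alpha J x ≤ R := by
  classical
  obtain ⟨e, he⟩ := IsSimilarToBlocks.exists_isCyclicFamily hJ fun i => (J i).exists_generator
  rw [alpha, Nat.card_eq_fintype_card]
  have h := he.subtype fun i => (J i).eigenvalue = x ∧ 2 ≤ (J i).size
  refine IsCyclicFamily.card_add_le_of_linear (x := x) (k := fun i => (J i).size)
    (e := fun i => e i) ?_ (fun i => i.2.2) hR
  convert h using 3 with i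
  exact congrArg _ (congrArg _ i.2.1.symm)

theorem RealJordanBlock.IsJordanForm.add_alpha_le {n r R : ℕ} {A : Matrix (Fin n) (Fin n) ℝ}
    {J : Fin r → RealJordanBlock} (hJ : IsJordanForm J A) (x : ℂ)
    (hR : IsSumOfPureTensors (![1, A] : TwoSliceTensor ℝ n n) R) : n + alpha J x ≤ R := by
  classical
  obtain ⟨e, he⟩ := IsSimilarToBlocks.exists_isCyclicFamily hJ fun i => (J i).exists_generator
  rw [alpha, Nat.card_eq_fintype_card]
  have h := he.subtype fun i => (J i).IsFor x ∧ 2 ≤ (J i).size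
  by_cases hx : x.im = 0
  · have hreal : ∀ b : RealJordanBlock, b.IsFor x → b.basePoly = X - C x.re ∧ b.exponent = b.size
    | real y k hk, hb => by
      have hb : x = (y : ℂ) := hb
      exact ⟨by simp [basePoly, hb], rfl⟩
    | nonreal c s hs k hk, hb => by
      rcases hb with hb | hb <;> simp [hb, hs] at hx
    refine IsCyclicFamily.card_add_le_of_linear (x := x.re) (k := fun i => (J i).size)
      (e := fun i => e i) ?_ (fun i => i.2.2) hR
    convert h using 2 with i
    rw [(hreal _ i.2.1).1, (hreal _ i.2.1).2]
  · have hnonreal : ∀ b : RealJordanBlock, b.IsFor x → b.basePoly = conjPairPoly x.re x.im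
    | real y k hk, hb => by
      have hb : x = (y : ℂ) := hb
      simp [hb] at hx
    | nonreal c s hs k hk, hb => by
      rcases hb with hb | hb <;> simp [hb, basePoly, conjPairPoly]
    refine IsCyclicFamily.card_add_le_of_quadratic (c := x.re) hx (k := fun i => (J i).exponent)
      (e := fun i => e i) ?_ (fun i => (J i).exponent_pos) hR
    convert h using 3 with i
    exact (hnonreal _ i.2.1).symm

theorem add_iSup_le {n R : ℕ} {f : ℂ → ℕ} (h : ∀ x, n + f x ≤ R) : n + ⨆ x, f x ≤ R := by
  have h1 : ⨆ x, f x ≤ R - n := ciSup_le fun x => by have := h x; omega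
  have := h 0
  omega

end JordanRank

theorem mainTheorem2 (n : ℕ) :
    (∀ A : Matrix (Fin n) (Fin n) ℂ,
      (∃ (r : ℕ) (J : Fin r → ComplexJordanBlock), ComplexJordanBlock.IsJordanForm J A) ∧
      ∀ (r : ℕ) (J : Fin r → ComplexJordanBlock), ComplexJordanBlock.IsJordanForm J A →
        tensorRank (![1, A] : TwoSliceTensor ℂ n n) =
            n + (⨆ x : ℂ, ComplexJordanBlock.alpha J x) ∧
        ∃ T : Fin (⨆ x : ℂ, ComplexJordanBlock.alpha J x) → TwoSliceTensor ℂ n n,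
          (∀ i, tensorRank (T i) = 1) ∧
          IsDiagonalizableTensor ((![1, A] : TwoSliceTensor ℂ n n) + ∑ i, T i)) ∧
    (∀ A : Matrix (Fin n) (Fin n) ℝ,
      (∃ (r : ℕ) (J : Fin r → RealJordanBlock), RealJordanBlock.IsJordanForm J A) ∧
      ∀ (r : ℕ) (J : Fin r → RealJordanBlock), RealJordanBlock.IsJordanForm J A →
        tensorRank (![1, A] : TwoSliceTensor ℝ n n) =
            n + (⨆ x : ℂ, RealJordanBlock.alpha J x) ∧
        ∃ T : Fin (⨆ x : ℂ, RealJordanBlock.alpha J x) → TwoSliceTensor ℝ n n,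
          (∀ i, tensorRank (T i) = 1) ∧
          IsDiagonalizableTensor ((![1, A] : TwoSliceTensor ℝ n n) + ∑ i, T i)) := by
  refine ⟨fun A => ⟨exists_complex_jordanForm A, fun r J hJ => ?_⟩,
    fun A => ⟨exists_real_jordanForm A, fun r J hJ => ?_⟩⟩
  · refine tensorRank_eq_of_diagonalizable_add
      (fun R hR => add_iSup_le fun x => hJ.add_alpha_le x hR) ?_
    obtain ⟨e, he⟩ := IsSimilarToBlocks.exists_isCyclicFamily hJ fun i => (J i).exists_generator
    refine he.exists_diagonalizable_add (fun i => irreducible_X_sub_C _)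
      (fun i => monic_X_sub_C _) (fun i => (J i).size_pos) ?_ fun i₀ => ?_
    · simpa using IsSimilarToBlocks.sum_size hJ
    · refine le_trans (le_of_eq ?_)
        (le_ciSup (ComplexJordanBlock.alpha_bddAbove J) (J i₀).eigenvalue)
      rw [ComplexJordanBlock.alpha]
      simp
  · refine tensorRank_eq_of_diagonalizable_add
      (fun R hR => add_iSup_le fun x => hJ.add_alpha_le x hR) ?_
    obtain ⟨e, he⟩ := IsSimilarToBlocks.exists_isCyclicFamily hJ fun i => (J i).exists_generator
    refine he.exists_diagonalizable_add (fun i => (J i).basePoly_irreducible)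
      (fun i => (J i).basePoly_monic) (fun i => (J i).exponent_pos) ?_ fun i₀ => ?_
    · simp only [RealJordanBlock.natDegree_basePoly_pow]
      exact IsSimilarToBlocks.sum_size hJ
    · -- blocks with the base polynomial of `J i₀` share each of its complex roots
      obtain ⟨x, hx⟩ := IsAlgClosed.exists_aeval_eq_zero ℂ (J i₀).basePoly
        (J i₀).basePoly_irreducible.degree_pos.ne'
      refine le_trans ?_ (le_ciSup (RealJordanBlock.alpha_bddAbove J) x)
      refine Nat.card_le_card_of_injective (fun i => ⟨i.1, ?_, ?_⟩) fun i i' hii => ?_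
      · rw [RealJordanBlock.isFor_iff, i.2.1, hx]
      · rw [← RealJordanBlock.natDegree_basePoly_pow]
        exact i.2.2
      · exact Subtype.ext (by simpa using hii)
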